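/- **Theorem (regret of R-less-UCB, stochastic rising restless bandits).** *Setting.* For a number of arms $K$ and a horizon $T$, let $\nu_i(t,n)$ ($i\in\{1,\dots,K\}$) be the reward law of arm $i$ when it is pulled at round $t$ and this is its $n$-th pull. For rounds $1\le t\le T$ the mean of $\nu_i(t,n)$ is $\mu_i(t)\in[0,1]$, independent of $n$ (restless), and the rewards are $\sigma^2$-subgaussian: $\mathbb E_{R\sim\nu_i(t,n)}[e^{\lambda(R-\mu_i(t))}]\le e^{\sigma^2\lambda^2/2}$ for all $\lambda\in\mathbb R$. With $\gamma_i(t)=\mu_i(t+1)-\mu_i(t)$, the bandit is rising on $\{1,\dots,T\}$: $\gamma_i(t)\ge0$ (for $1\le t\le T-1$) and $\gamma_i(t+1)\le\gamma_i(t)$ (for $1\le t\le T-2$). A policy $\pi$ chooses the arm $I_t$ of round $t$ as a (measurable) function of the history $(I_l,R_l)_{l<t}$; then $R_t\sim\nu_{I_t}(t,N_{I_t,t})$, where $N_{i,t}$ is the number of pulls of arm $i$ in rounds $1,\dots,t$. The expected regret is $R_\mu(\pi,T)=\sup_{\pi'}J(\pi',T)-J(\pi,T)$ with $J(\pi,T)=\mathbb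 E\big[\sum_{t\le T}\mu_{I_t}(t)\big]$. The cumulative increment is $\Upsilon_\mu(M,q)=\sum_{l=1}^{M-1}\max_i\gamma_i(l)^q$ (with $0^0=1$). *Algorithm.* R-less-UCB with parameters $\sigma>0$, $\epsilon\in(0,1/2)$, $\alpha>2$ pulls, at each round $t$, an arm maximizing $B_i(t)=\widehat\mu_i^{h}(t)+\beta_i^{h}(t,\delta_t)$ (ties broken arbitrarily), with $N=N_{i,t-1}$, $h=\lfloor\epsilon N\rfloor$, $\delta_t=t^{-\alpha}$ and, if $h\ge1$, $$\widehat\mu_i^{h}(t)=\frac1h\sum_{l=N-h+1}^{N}\Big(R_{t_{i,l}}+(t-l)\frac{R_{t_{i,l}}-R_{t_{i,l-h}}}{h}\Big),\qquad \beta_i^{h}(t,\delta)=\sigma\,(t-N+h-1)\sqrt{\frac{10\log(1/\delta)}{h^3}},$$ where $t_{i,l}$ is the round of the $l$-th pull of arm $i$; if $h=0$, both are $+\infty$. *Claim.* There is a universal constant $C>0$ such that for all $\sigma>0$ and $\alpha>2$ there is $T_0=T_0(\sigma,\alpha)$ such that, for all $K$, all $\epsilon\in(0,1/2)$, all $T\ge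 T_0$ with $(1-2\epsilon)T>K$, every bandit as above, every version $\pi$ of R-less-UCB and every $q\in[0,1]$, $$R_\mu(\pi,T)\le C\left(\frac K\epsilon(\sigma T)^{2/3}(\alpha\log T)^{1/3}+\frac{K\,T^{\frac{2q}{1+q}}(\log T)^{\frac q{1+q}}}{\epsilon(1-2\epsilon)}\;\Upsilon_\mu\!\left(\left\lceil\frac{(1-2\epsilon)T}{K}\right\rceil,q\right)^{\frac1{1+q}}\right).$$ -/

import Mathlib

noncomputable section

namespace RisingBandit

open MeasureTheory ProbabilityTheory

/-- A `K`-armed bandit: `ν i t n` is the law of the reward of arm `i` when it is pulled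
at round `t` (rounds are numbered from `1`) and this is its `n`-th pull. -/
abbrev Bandit (K : ℕ) : Type := Fin K → ℕ → ℕ → ProbabilityMeasure ℝ

/-- The payoff `μ_i(t, n)`: the expectation of the reward law `ν_i(t, n)`. -/
def payoff {K : ℕ} (ν : Bandit K) (i : Fin K) (t n : ℕ) : ℝ :=
  ∫ r, r ∂(ν i t n : Measure ℝ)

/-- The history `(I_l, R_l)_{l = 1, …, n}` of the first `n` rounds; the pair of round `l` is
stored at position `l - 1`. -/
abbrev History (K n : ℕ) : Type := Fin n → Fin K × ℝ

/-- `N_{i,m}`: the number of pulls of arm `i` in the rounds `1, …, m` of the history `h`. -/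
def pulls {K n : ℕ} (h : History K n) (i : Fin K) (m : ℕ) : ℕ :=
  (Finset.univ.filter fun s : Fin n => (s : ℕ) < m ∧ (h s).1 = i).card

/-- `R_{t_{i,l}}`: the reward observed at the (unique) round at which arm `i` was pulled for the
`l`-th time. The sum below has exactly one term when `1 ≤ l ≤ N_{i,n}` (and none otherwise). -/
def pullReward {K n : ℕ} (h : History K n) (i : Fin K) (l : ℕ) : ℝ :=
  ∑ s : Fin n, if (h s).1 = i ∧ pulls h i (s + 1) = l then (h s).2 else 0

/-- A deterministic non-stationary policy: at round `n + 1` it maps the history of the first `n`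
rounds, measurably, to an arm. -/
structure Policy (K : ℕ) where
  act : (n : ℕ) → History K n → Fin K
  measurable_act : ∀ n, Measurable (act n)

/-- The law of the history of the first `n` rounds when policy `π` is run on the bandit `ν`:
given the history `h` of the first `n` rounds, the arm `I = π(h)` is pulled at round `n + 1`, and
the reward is drawn from `ν_I(n + 1, N_{I,n} + 1)`. -/
def histLaw {K : ℕ} (ν : Bandit K) (π : Policy K) : (n : ℕ) → Measure (History K n)
  | 0 => Measure.dirac (fun s => s.elim0)
  | n + 1 => (histLaw ν π n).bind fun h =>
      (ν (π.act n h) (n + 1) (pulls h (π.act n h) n + 1) : Measure ℝ).map fun r =>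
        Fin.snoc (α := fun _ => Fin K × ℝ) h (π.act n h, r)

/-- The expected cumulative reward `J(π, T) = 𝔼[∑_{t ≤ T} μ_{I_t}(t, N_{I_t,t})]`. -/
def expectedReward {K : ℕ} (ν : Bandit K) (π : Policy K) (T : ℕ) : ℝ :=
  ∫ h, ∑ s : Fin T, payoff ν (h s).1 (s + 1) (pulls h (h s).1 (s + 1)) ∂(histLaw ν π T)

/-- The expected cumulative regret `R(π, T) = sup_{π'} J(π', T) - J(π, T)`. -/
def regret {K : ℕ} (ν : Bandit K) (π : Policy K) (T : ℕ) : ℝ :=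
  (⨆ π' : Policy K, expectedReward ν π' T) - expectedReward ν π T

/-- The increment `γ_i(t) = μ_i(t + 1) - μ_i(t)` of a restless arm. -/
def increment {K : ℕ} (μ : Fin K → ℕ → ℝ) (i : Fin K) (t : ℕ) : ℝ :=
  μ i (t + 1) - μ i t

/-- The cumulative increment `Υ_μ(M, q) = ∑_{l = 1}^{M - 1} max_i γ_i(l)^q` (with `0^0 = 1`). -/
def cumIncrement {K : ℕ} (μ : Fin K → ℕ → ℝ) (M : ℕ) (q : ℝ) : ℝ :=
  ∑ l ∈ Finset.Ico 1 M, ⨆ i : Fin K, increment μ i l ^ q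

/-- `ν` is a rising restless bandit over the rounds `1, …, T`, with payoffs `μ_i(t) ∈ [0, 1]` and
`σ²`-subgaussian rewards: the payoff does not depend on the number of pulls, and it is
non-decreasing and concave in the round. -/
structure IsRisingRestless {K : ℕ} (T : ℕ) (σ : ℝ) (ν : Bandit K) (μ : Fin K → ℕ → ℝ) :
    Prop where
  restless : ∀ i n, ∀ t ∈ Set.Icc 1 T, payoff ν i t n = μ i t
  bounded : ∀ i, ∀ t ∈ Set.Icc 1 T, μ i t ∈ Set.Icc (0 : ℝ) 1
  subgaussian : ∀ i n, ∀ t ∈ Set.Icc 1 T,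
    HasSubgaussianMGF (fun r : ℝ => r - μ i t) (σ ^ 2).toNNReal (ν i t n : Measure ℝ)
  nonDecreasing : ∀ i t, 1 ≤ t → t + 1 ≤ T → 0 ≤ increment μ i t
  concave : ∀ i t, 1 ≤ t → t + 2 ≤ T → increment μ i (t + 1) ≤ increment μ i t

/-- The windowed estimator `\hat μ_i^h(t)` at round `t = n + 1`, computed from the history of the
first `n` rounds; here `N` stands for `N_{i,t-1}`. It is `+∞` unless `1 ≤ h ≤ ⌊N / 2⌋`. -/
def estimator {K n : ℕ} (H : History K n) (i : Fin K) (h : ℕ) : EReal :=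
  let t : ℝ := n + 1
  let N : ℕ := pulls H i n
  if 1 ≤ h ∧ h ≤ N / 2 then
    (((1 / (h : ℝ)) * ∑ l ∈ Finset.Icc (N - h + 1) N,
      (pullReward H i l + (t - l) * ((pullReward H i l - pullReward H i (l - h)) / h)) : ℝ) :
      EReal)
  else ⊤

/-- The exploration bonus `β_i^h(t, δ) = σ (t - N_{i,t-1} + h - 1) √(10 log(1/δ) / h³)` at round
`t = n + 1`; it is `+∞` when `h = 0`. -/
def bonus {K n : ℕ} (σ : ℝ) (H : History K n) (i : Fin K) (h : ℕ) (δ : ℝ) : EReal :=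
  let t : ℝ := n + 1
  let N : ℕ := pulls H i n
  if h = 0 then ⊤
  else ((σ * (t - N + h - 1) * Real.sqrt (10 * Real.log (1 / δ) / (h : ℝ) ^ 3) : ℝ) : EReal)

/-- The exploration index `B_i(t) = \hat μ_i^h(t) + β_i^h(t, δ_t)` at round `t = n + 1`, with
window `h = ⌊ε N_{i,t-1}⌋` and confidence `δ_t = t^{-α}`. -/
def index {K n : ℕ} (σ ε α : ℝ) (H : History K n) (i : Fin K) : EReal :=
  let h : ℕ := ⌊ε * (pulls H i n : ℝ)⌋₊
  let δ : ℝ := ((n : ℝ) + 1) ^ (-α)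
  estimator H i h + bonus σ H i h δ

/-- `π` is an instance of `R-less-UCB` (run for `T` rounds): at each round it pulls an arm of
maximal index, with ties broken in any way. -/
def IsRLessUCB {K : ℕ} (T : ℕ) (σ ε α : ℝ) (π : Policy K) : Prop :=
  ∀ n < T, ∀ (H : History K n) (i : Fin K), index σ ε α H i ≤ index σ ε α H (π.act n H)

end RisingBandit

end

/-!
Since the pulls do not influence the payoffs, no policy beats the oracle that always pulls the best
arm, so the regret is at most the expected sum of the gaps between the best arm and the arm pulled
(`regret_le_integral`).

With the payoffs in place of the rewards, the windowed estimator averages, over the pulls in the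
window, the payoff of a pull extrapolated to the current round along a secant. By concavity such an
extrapolation overshoots the current payoff (`le_windowEstimate_pullMean`), by at most
`T² γ_i(k) / h`, where `h = ⌊ε N⌋` is the window, `N` the number of pulls and
`k = ⌊(1 - 2 ε) N⌋ + 1` is no later than any pull that the estimator uses
(`windowEstimate_pullMean_le`).
The noise of the estimator is a sum of centred rewards whose weights depend on the pull number
only. If the final number of pulls is fixed, the weights are deterministic, and an exponential
supermartingale (`lintegral_exp_noiseSum_le_one`) gives Hoeffding's inequality; a union bound over
the arms and the possible numbers of pulls shows that some bonus fails to cover the noise at round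
`t` with probability at most `2 K t^(1 - α)` (`histLaw_badEvent_le`). For `α > 2` this is summable,
and the horizon threshold absorbs the sum.

Otherwise the arm of maximal index has a gap of at most its bias plus twice its bonus
(`bestPayoff_sub_le_gapBound`), or its window is empty. This bound depends on the arm and its number
of pulls alone, so the gaps can be added up arm by arm and pull by pull. Each window length occurs
at most `1 / ε + 1` times. With `B³ = 40 (σ T)² α log T`, the bonuses contribute
`∑_h min(1, (B / h)^(3/2)) ≤ 3 B + 1` (`sum_min_one_sqrt_le`), whence the first term of the regret
bound. The biases, truncated at `1`, are at most their powers of exponent `q / (1 + q)`, and Hölder's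
inequality separates the harmonic sum `∑ 1 / h`, of order `log T / ε`, from a sum of `γ^q`, which is
a cumulative increment up to the factor `1 / (1 - 2 ε) + 1` (`sum_bias_le`). As the increments
decrease, the cumulative increments up to `(1 - 2 ε) N`, for `N` pulls of one arm, and up to
`(1 - 2 ε) T / K`, for the average number of pulls, compare linearly in the number of their terms
(`sum_range_le_of_antitone`), which gives the second term.
-/

namespace RisingBandit

open MeasureTheory ProbabilityTheory

/-! ### The law of the history -/

/-- The first `m` rounds of a history. -/
def truncate {K n : ℕ} (H : History K n) (m : ℕ) (hm : m ≤ n) : History K m :=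
  fun s => H (Fin.castLE hm s)

/-- The history `h` extended by one round, in which arm `a` was pulled and paid `r`. -/
def extend {K n : ℕ} (h : History K n) (a : Fin K) (r : ℝ) : History K (n + 1) :=
  Fin.snoc (α := fun _ => Fin K × ℝ) h (a, r)

lemma pulls_eq_sum {K n : ℕ} (h : History K n) (i : Fin K) (m : ℕ) :
    pulls h i m = ∑ s : Fin n, if (s : ℕ) < m ∧ (h s).1 = i then 1 else 0 := by
  rw [pulls, Finset.card_filter]

lemma pulls_truncate {K n : ℕ} (H : History K n) (i : Fin K) {m k : ℕ} (hm : m ≤ n)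
    (hk : k ≤ m) : pulls (truncate H m hm) i k = pulls H i k := by
  rw [pulls, pulls]
  refine Finset.card_bij (fun s _ => Fin.castLE hm s) ?_ ?_ ?_
  · intro s hs
    rw [Finset.mem_filter] at hs ⊢
    exact ⟨Finset.mem_univ _, hs.2⟩
  · intro s _ s' _ h
    exact Fin.castLE_injective hm h
  · intro s hs
    rw [Finset.mem_filter] at hs
    exact ⟨⟨s, by omega⟩, Finset.mem_filter.2 ⟨Finset.mem_univ _, hs.2⟩, rfl⟩

lemma truncate_extend {K n : ℕ} (h : History K n) (a : Fin K) (r : ℝ) {m : ℕ} (hm : m ≤ n) :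
    truncate (extend h a r) m (by omega) = truncate h m hm := by
  funext s
  exact Fin.snoc_castSucc (α := fun _ => Fin K × ℝ) (a, r) h (Fin.castLE hm s)

lemma truncate_self {K n : ℕ} (h : History K n) : truncate h n le_rfl = h := rfl

lemma extend_castSucc {K n : ℕ} (h : History K n) (a : Fin K) (r : ℝ) (s : Fin n) :
    extend h a r s.castSucc = h s :=
  Fin.snoc_castSucc (α := fun _ => Fin K × ℝ) (a, r) h s

lemma extend_last {K n : ℕ} (h : History K n) (a : Fin K) (r : ℝ) :
    extend h a r (Fin.last n) = (a, r) :=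
  Fin.snoc_last (α := fun _ => Fin K × ℝ) (a, r) h

lemma pulls_extend {K n : ℕ} (h : History K n) (a : Fin K) (r : ℝ) (i : Fin K) {m : ℕ}
    (hm : m ≤ n) : pulls (extend h a r) i m = pulls h i m := by
  rw [← pulls_truncate (extend h a r) i (Nat.le_succ n) hm, truncate_extend h a r le_rfl,
    truncate_self]

lemma pulls_succ {K n : ℕ} (h : History K n) (i : Fin K) (s : Fin n) :
    pulls h i (s + 1) = pulls h i s + if (h s).1 = i then 1 else 0 := by
  have hs : (if (h s).1 = i then 1 else 0 : ℕ)
      = ∑ u : Fin n, if u = s then (if (h s).1 = i then 1 else 0) else 0 := by simp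
  rw [hs, pulls_eq_sum, pulls_eq_sum, ← Finset.sum_add_distrib]
  refine Finset.sum_congr rfl fun u _ => ?_
  by_cases hu : u = s
  · subst hu; simp
  · have : (u : ℕ) < s + 1 ↔ (u : ℕ) < s := by
      have : (u : ℕ) ≠ s := fun h => hu (Fin.ext h)
      omega
    simp [hu, this]

lemma measurable_pulls {K n : ℕ} (i : Fin K) (m : ℕ) :
    Measurable fun h : History K n => pulls h i m := by
  simp_rw [pulls_eq_sum]
  refine Finset.measurable_sum _ fun s _ => Measurable.ite ?_ measurable_const measurable_const
  exact (MeasurableSet.const _).inter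
    ((measurable_fst.comp (measurable_pi_apply s)) (measurableSet_singleton i))

lemma measurable_extend {K n : ℕ} :
    Measurable fun p : History K n × Fin K × ℝ => extend p.1 p.2.1 p.2.2 := by
  refine measurable_pi_lambda _ fun s => ?_
  induction s using Fin.lastCases with
  | last => simpa only [extend_last] using measurable_snd
  | cast s =>
    simp only [extend_castSucc]
    exact (measurable_pi_apply s).comp measurable_fst

lemma measurable_truncate {K n : ℕ} (m : ℕ) (hm : m ≤ n) :
    Measurable fun h : History K n => truncate h m hm :=
  measurable_pi_lambda _ fun s => measurable_pi_apply (Fin.castLE hm s)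

/-- The law of the reward that policy `π` collects at round `n + 1` after the history `h`, as a
Markov kernel. -/
def rewardKernel {K : ℕ} (ν : Bandit K) (π : Policy K) (n : ℕ) : Kernel (History K n) ℝ where
  toFun h := (ν (π.act n h) (n + 1) (pulls h (π.act n h) n + 1) : Measure ℝ)
  measurable' := by
    have h₁ : Measurable fun h : History K n => pulls h (π.act n h) n := by
      have : Measurable fun p : Fin K × History K n => pulls p.2 p.1 n :=
        measurable_from_prod_countable_right fun i => measurable_pulls i n
      exact this.comp ((π.measurable_act n).prodMk measurable_id)
    have h₂ : Measurable fun p : Fin K × ℕ => (ν p.1 (n + 1) (p.2 + 1) : Measure ℝ) :=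
      Measurable.of_discrete
    exact h₂.comp ((π.measurable_act n).prodMk h₁)

instance {K : ℕ} (ν : Bandit K) (π : Policy K) (n : ℕ) :
    IsMarkovKernel (rewardKernel ν π n) :=
  ⟨fun h => inferInstanceAs (IsProbabilityMeasure
    (ν (π.act n h) (n + 1) (pulls h (π.act n h) n + 1) : Measure ℝ))⟩

lemma measurable_extend_act {K : ℕ} (π : Policy K) (n : ℕ) :
    Measurable fun p : History K n × ℝ => extend p.1 (π.act n p.1) p.2 :=
  measurable_extend.comp (measurable_fst.prodMk
    (((π.measurable_act n).comp measurable_fst).prodMk measurable_snd))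

lemma histLaw_succ {K : ℕ} (ν : Bandit K) (π : Policy K) (n : ℕ) :
    histLaw ν π (n + 1) = (histLaw ν π n).bind fun h =>
      (rewardKernel ν π n h).map fun r => extend h (π.act n h) r := rfl

lemma measurable_step {K : ℕ} (ν : Bandit K) (π : Policy K) (n : ℕ) :
    Measurable fun h => (rewardKernel ν π n h).map fun r => extend h (π.act n h) r := by
  refine Measure.measurable_of_measurable_coe _ fun A hA => ?_
  have hm (h : History K n) : Measurable fun r => extend h (π.act n h) r :=
    (measurable_extend_act π n).comp measurable_prodMk_left
  simp_rw [fun h => Measure.map_apply (μ := rewardKernel ν π n h) (hm h) hA]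
  exact Kernel.measurable_kernel_prodMk_left (measurable_extend_act π n hA)

lemma lintegral_histLaw_succ {K : ℕ} (ν : Bandit K) (π : Policy K) (n : ℕ)
    {F : History K (n + 1) → ENNReal} (hF : Measurable F) :
    ∫⁻ h, F h ∂(histLaw ν π (n + 1)) =
      ∫⁻ h, ∫⁻ r, F (extend h (π.act n h) r) ∂(rewardKernel ν π n h) ∂(histLaw ν π n) := by
  rw [histLaw_succ, Measure.lintegral_bind (measurable_step ν π n).aemeasurable hF.aemeasurable]
  refine lintegral_congr fun h => ?_
  have hm : Measurable fun r => extend h (π.act n h) r :=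
    (measurable_extend_act π n).comp measurable_prodMk_left
  rw [lintegral_map hF hm]

instance isProbabilityMeasure_histLaw {K : ℕ} (ν : Bandit K) (π : Policy K) (n : ℕ) :
    IsProbabilityMeasure (histLaw ν π n) := by
  induction n with
  | zero => exact Measure.dirac.isProbabilityMeasure
  | succ n ih =>
    refine ⟨?_⟩
    have := lintegral_histLaw_succ ν π n (F := fun _ => 1) measurable_const
    simpa using this

/-- The law of the first `m` rounds of an `n`-round history is the law of an `m`-round history. -/
lemma map_truncate_histLaw {K : ℕ} (ν : Bandit K) (π : Policy K) {m n : ℕ} (hm : m ≤ n) :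
    (histLaw ν π n).map (fun h => truncate h m hm) = histLaw ν π m := by
  induction n, hm using Nat.le_induction with
  | base => exact Measure.map_id
  | succ n hm ih =>
    rw [← ih]
    refine Measure.ext_of_lintegral _ fun F hF => ?_
    rw [lintegral_map hF (measurable_truncate m _), lintegral_map hF (measurable_truncate m hm),
      lintegral_histLaw_succ ν π n (F := fun h => F (truncate h m (hm.trans n.le_succ)))
        (hF.comp (measurable_truncate m _))]
    refine lintegral_congr fun h => ?_
    simp [truncate_extend _ _ _ hm]

/-- Almost surely, the arms recorded in the history are those that the policy chooses. -/
lemma ae_eq_act {K : ℕ} (ν : Bandit K) (π : Policy K) (n : ℕ) :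
    ∀ᵐ h ∂(histLaw ν π n), ∀ s : Fin n, (h s).1 = π.act s (truncate h s s.2.le) := by
  have hset (n : ℕ) : MeasurableSet
      {h : History K n | ¬ ∀ s : Fin n, (h s).1 = π.act s (truncate h s s.2.le)} := by
    rw [← Set.compl_ofPred, Set.ofPred_forall]
    refine MeasurableSet.compl ?_
    refine MeasurableSet.iInter fun s => ?_
    exact measurableSet_eq_fun (measurable_fst.comp (measurable_pi_apply s))
      ((π.measurable_act s).comp (measurable_truncate _ _))
  induction n with
  | zero => exact Filter.Eventually.of_forall fun h s => s.elim0
  | succ n ih =>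
    rw [ae_iff, ← lintegral_indicator_one (hset _),
      lintegral_histLaw_succ ν π n (measurable_one.indicator (hset _))]
    rw [lintegral_eq_zero_iff']
    · filter_upwards [ih] with h hh
      have (r : ℝ) : extend h (π.act n h) r ∉ {h : History K (n + 1) |
          ¬ ∀ s : Fin (n + 1), (h s).1 = π.act s (truncate h s s.2.le)} := by
        simp only [Set.mem_ofPred_eq, not_not]
        intro s
        induction s using Fin.lastCases with
        | last =>
          rw [extend_last]
          exact (congrArg (π.act n) (truncate_extend h (π.act n h) r le_rfl)).symm
        | cast s =>
          rw [extend_castSucc, hh s]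
          exact (congrArg (π.act s) (truncate_extend h (π.act n h) r s.2.le)).symm
      simp only [Set.indicator_of_notMem (this _), lintegral_zero, Pi.zero_apply]
    · refine Measurable.aemeasurable ?_
      exact Measurable.lintegral_kernel_prod_right (κ := rewardKernel ν π n)
        ((measurable_one.indicator (hset _)).comp (measurable_extend_act π n))

/-! ### Concentration of weighted reward sums -/

/-- Summing over the rounds at which arm `i` is pulled is summing over its pull numbers. -/
lemma sum_pulls_of_le {K n : ℕ} (H : History K n) (i : Fin K) (f : ℕ → ℝ) {m : ℕ} (hm : m ≤ n) :
    ∑ s : Fin m, (if (H (Fin.castLE hm s)).1 = i then f (pulls H i s) else 0) =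
      ∑ l ∈ Finset.range (pulls H i m), f l := by
  induction m with
  | zero => simp [pulls]
  | succ m ih =>
    have h := pulls_succ H i ⟨m, hm⟩
    rw [Fin.sum_univ_castSucc]
    have ih' := ih (by omega)
    simp only [Fin.castLE_castSucc, Fin.val_castSucc, Fin.val_last] at ih' ⊢
    rw [ih']
    change _ + (if (H ⟨m, hm⟩).1 = i then _ else _) = _
    simp only at h
    rw [h]
    split_ifs <;> simp [Finset.sum_range_succ]

lemma sum_pulls {K n : ℕ} (H : History K n) (i : Fin K) (f : ℕ → ℝ) :
    ∑ s : Fin n, (if (H s).1 = i then f (pulls H i s) else 0) =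
      ∑ l ∈ Finset.range (pulls H i n), f l :=
  sum_pulls_of_le H i f le_rfl

lemma pulls_le {K n : ℕ} (H : History K n) (i : Fin K) (m : ℕ) : pulls H i m ≤ n := by
  exact (Finset.card_filter_le _ _).trans_eq (Finset.card_fin n)

/-- The sum of the centred rewards of arm `i`, where the `l`-th pull has weight `w l`. -/
def noiseSum {K n : ℕ} (μ : Fin K → ℕ → ℝ) (i : Fin K) (w : ℕ → ℝ) (H : History K n) : ℝ :=
  ∑ s : Fin n, if (H s).1 = i then w (pulls H i s + 1) * ((H s).2 - μ i (s + 1)) else 0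

/-- The sum of the squares of the weights that occur in `noiseSum`. -/
def squaredWeight {K n : ℕ} (i : Fin K) (w : ℕ → ℝ) (H : History K n) : ℝ :=
  ∑ s : Fin n, if (H s).1 = i then w (pulls H i s + 1) ^ 2 else 0

lemma noiseSum_extend {K n : ℕ} (μ : Fin K → ℕ → ℝ) (i : Fin K) (w : ℕ → ℝ) (H : History K n)
    (a : Fin K) (r : ℝ) : noiseSum μ i w (extend H a r) = noiseSum μ i w H +
      if a = i then w (pulls H i n + 1) * (r - μ i (n + 1)) else 0 := by
  simp [noiseSum, Fin.sum_univ_castSucc, extend_castSucc, extend_last, pulls_extend]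

lemma squaredWeight_extend {K n : ℕ} (i : Fin K) (w : ℕ → ℝ) (H : History K n) (a : Fin K)
    (r : ℝ) : squaredWeight i w (extend H a r) = squaredWeight i w H +
      if a = i then w (pulls H i n + 1) ^ 2 else 0 := by
  simp [squaredWeight, Fin.sum_univ_castSucc, extend_castSucc, extend_last, pulls_extend]

lemma measurableSet_arm {K n : ℕ} (i : Fin K) (s : Fin n) :
    MeasurableSet {H : History K n | (H s).1 = i} :=
  (measurable_fst.comp (measurable_pi_apply s)) (measurableSet_singleton i)

lemma measurable_noiseSum {K n : ℕ} (μ : Fin K → ℕ → ℝ) (i : Fin K) (w : ℕ → ℝ) :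
    Measurable fun H : History K n => noiseSum μ i w H := by
  refine Finset.measurable_sum _ fun s _ =>
    Measurable.ite (measurableSet_arm i s) (Measurable.mul ?_ ?_) measurable_const
  · exact (Measurable.of_discrete (f := fun k : ℕ => w (k + 1))).comp (measurable_pulls i s)
  · exact (measurable_snd.comp (measurable_pi_apply s)).sub measurable_const

lemma measurable_squaredWeight {K n : ℕ} (i : Fin K) (w : ℕ → ℝ) :
    Measurable fun H : History K n => squaredWeight i w H := by
  refine Finset.measurable_sum _ fun s _ =>
    Measurable.ite (measurableSet_arm i s) ?_ measurable_const
  exact (Measurable.of_discrete (f := fun k : ℕ => w (k + 1) ^ 2)).comp (measurable_pulls i s)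

/-- The exponential supermartingale of the weighted noise: each round multiplies it by a factor
of conditional expectation at most `1`, by subgaussianity. -/
lemma lintegral_exp_noiseSum_le_one {K T : ℕ} {σ : ℝ} {ν : Bandit K} {μ : Fin K → ℕ → ℝ}
    (hν : IsRisingRestless T σ ν μ) (π : Policy K) (i : Fin K) (w : ℕ → ℝ) (c : ℝ) {n : ℕ}
    (hn : n ≤ T) :
    ∫⁻ H, ENNReal.ofReal (Real.exp (c * noiseSum μ i w H -
      c ^ 2 * σ ^ 2 / 2 * squaredWeight i w H)) ∂(histLaw ν π n) ≤ 1 := by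
  have hmeas (n : ℕ) : Measurable fun H : History K n => ENNReal.ofReal (Real.exp
      (c * noiseSum μ i w H - c ^ 2 * σ ^ 2 / 2 * squaredWeight i w H)) :=
    (Real.measurable_exp.comp (((measurable_noiseSum μ i w).const_mul c).sub
      ((measurable_squaredWeight i w).const_mul _))).ennreal_ofReal
  induction n with
  | zero => simp [noiseSum, squaredWeight]
  | succ n ih =>
    rw [lintegral_histLaw_succ ν π n (hmeas _)]
    refine le_trans (lintegral_mono fun H => ?_) (ih (by omega))
    simp only [noiseSum_extend, squaredWeight_extend]
    by_cases ha : π.act n H = i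
    · simp only [ha, if_true]
      set v := w (pulls H i n + 1)
      set E := c * noiseSum μ i w H - c ^ 2 * σ ^ 2 / 2 * squaredWeight i w H
      have hker : rewardKernel ν π n H = (ν i (n + 1) (pulls H i n + 1) : Measure ℝ) := by
        rw [← ha]; rfl
      have hsub := hν.subgaussian i (pulls H i n + 1) (n + 1) ⟨by omega, hn⟩
      have hexp (r : ℝ) : Real.exp (c * (noiseSum μ i w H + v * (r - μ i (n + 1))) -
          c ^ 2 * σ ^ 2 / 2 * (squaredWeight i w H + v ^ 2)) =
          Real.exp (E - c ^ 2 * σ ^ 2 / 2 * v ^ 2) * Real.exp (c * v * (r - μ i (n + 1))) := by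
        rw [← Real.exp_add]; congr 1; ring
      simp_rw [hexp]
      rw [hker, ← ofReal_integral_eq_lintegral_ofReal
        ((hsub.integrable_exp_mul (c * v)).const_mul _)
        (Filter.Eventually.of_forall fun r => by positivity), integral_const_mul]
      refine ENNReal.ofReal_le_ofReal ?_
      have hmgf := hsub.mgf_le (c * v)
      rw [Real.coe_toNNReal _ (sq_nonneg σ)] at hmgf
      calc _ ≤ Real.exp (E - c ^ 2 * σ ^ 2 / 2 * v ^ 2) * Real.exp (σ ^ 2 * (c * v) ^ 2 / 2) := by
            gcongr; exact hmgf
        _ = Real.exp E := by rw [← Real.exp_add]; congr 1; ring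
    · simp [ha]

lemma squaredWeight_le {K n : ℕ} (i : Fin K) (w : ℕ → ℝ) (H : History K n) :
    squaredWeight i w H ≤ ∑ l ∈ Finset.range n, w (l + 1) ^ 2 := by
  rw [squaredWeight, sum_pulls H i fun l => w (l + 1) ^ 2]
  exact Finset.sum_le_sum_of_subset_of_nonneg (Finset.range_mono (pulls_le H i n))
    fun _ _ _ => sq_nonneg _

lemma histLaw_noiseSum_ge_le {K T : ℕ} {σ : ℝ} {ν : Bandit K} {μ : Fin K → ℕ → ℝ} (hσ : 0 < σ)
    (hν : IsRisingRestless T σ ν μ) (π : Policy K) (i : Fin K) (w : ℕ → ℝ) {n : ℕ}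
    (hn : n ≤ T) {V b : ℝ} (hV : 0 < V) (hw : ∑ l ∈ Finset.range n, w (l + 1) ^ 2 ≤ V)
    (hb : 0 ≤ b) : histLaw ν π n {H | b ≤ noiseSum μ i w H} ≤
      ENNReal.ofReal (Real.exp (-b ^ 2 / (2 * (σ ^ 2 * V)))) := by
  -- the exponent `c b - c² σ² V / 2` is largest at this `c`
  set c : ℝ := b / (σ ^ 2 * V) with hc
  have hc0 : 0 ≤ c := by positivity
  set X : History K n → ENNReal := fun H => ENNReal.ofReal (Real.exp (c * noiseSum μ i w H -
      c ^ 2 * σ ^ 2 / 2 * squaredWeight i w H)) with hX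
  have hXm : Measurable X :=
    (Real.measurable_exp.comp (((measurable_noiseSum μ i w).const_mul c).sub
      ((measurable_squaredWeight i w).const_mul _))).ennreal_ofReal
  have hmarkov := mul_meas_ge_le_lintegral (μ := histLaw ν π n) hXm
    (ENNReal.ofReal (Real.exp (b ^ 2 / (2 * (σ ^ 2 * V)))))
  have hle := hmarkov.trans (lintegral_exp_noiseSum_le_one hν π i w c hn)
  have hsub : {H | b ≤ noiseSum μ i w H} ⊆
      {H | ENNReal.ofReal (Real.exp (b ^ 2 / (2 * (σ ^ 2 * V)))) ≤ X H} := by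
    intro H hH
    refine ENNReal.ofReal_le_ofReal (Real.exp_le_exp.2 ?_)
    have hH' : b ≤ noiseSum μ i w H := hH
    have h₁ : c * b ≤ c * noiseSum μ i w H := by gcongr
    have h₂ : c ^ 2 * σ ^ 2 / 2 * squaredWeight i w H ≤ c ^ 2 * σ ^ 2 / 2 * V := by
      gcongr; exact (squaredWeight_le i w H).trans hw
    have h₃ : b ^ 2 / (2 * (σ ^ 2 * V)) = c * b - c ^ 2 * σ ^ 2 / 2 * V := by
      rw [hc]; field_simp; ring
    linarith
  rw [neg_div, Real.exp_neg, ENNReal.ofReal_inv_of_pos (Real.exp_pos _)]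
  rw [← one_div, ENNReal.le_div_iff_mul_le (Or.inl (by simp [Real.exp_pos]))
    (Or.inl ENNReal.ofReal_ne_top), mul_comm]
  exact le_trans (by gcongr) hle

/-- Hoeffding's inequality for the rewards of one arm, weighted by pull number. -/
lemma histLaw_abs_noiseSum_ge_le {K T : ℕ} {σ : ℝ} {ν : Bandit K} {μ : Fin K → ℕ → ℝ}
    (hσ : 0 < σ) (hν : IsRisingRestless T σ ν μ) (π : Policy K) (i : Fin K) (w : ℕ → ℝ) {n : ℕ}
    (hn : n ≤ T) {V b : ℝ} (hV : 0 < V) (hw : ∑ l ∈ Finset.range n, w (l + 1) ^ 2 ≤ V)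
    (hb : 0 ≤ b) : histLaw ν π n {H | b ≤ |noiseSum μ i w H|} ≤
      2 * ENNReal.ofReal (Real.exp (-b ^ 2 / (2 * (σ ^ 2 * V)))) := by
  have hneg (H : History K n) : noiseSum μ i (fun l => -w l) H = -noiseSum μ i w H := by
    simp [noiseSum, ← Finset.sum_neg_distrib, apply_ite]
  have h₁ := histLaw_noiseSum_ge_le hσ hν π i w hn hV hw hb
  have h₂ := histLaw_noiseSum_ge_le hσ hν π i (fun l => -w l) hn hV (by simpa using hw) hb
  have hsub : {H : History K n | b ≤ |noiseSum μ i w H|} ⊆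
      {H | b ≤ noiseSum μ i w H} ∪ {H | b ≤ noiseSum μ i (fun l => -w l) H} := by
    intro H hH
    have hH' : b ≤ |noiseSum μ i w H| := hH
    rcases le_abs.1 hH' with h | h
    · exact Or.inl h
    · exact Or.inr (show b ≤ noiseSum μ i (fun l => -w l) H by rwa [hneg])
  rw [two_mul]
  exact (measure_mono hsub).trans ((measure_union_le _ _).trans (add_le_add h₁ h₂))

/-! ### Pull times -/

lemma pulls_mono {K n : ℕ} (H : History K n) (i : Fin K) {m m' : ℕ} (h : m ≤ m') :
    pulls H i m ≤ pulls H i m' :=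
  Finset.card_le_card (Finset.monotone_filter_right _ fun _ _ hs => ⟨hs.1.trans_le h, hs.2⟩)

lemma pulls_zero {K n : ℕ} (H : History K n) (i : Fin K) : pulls H i 0 = 0 := by
  simp [pulls]

lemma pulls_le_add {K n : ℕ} (H : History K n) (i : Fin K) {m m' : ℕ} (h : m ≤ m')
    (hm' : m' ≤ n) : pulls H i m' ≤ pulls H i m + (m' - m) := by
  induction m', h using Nat.le_induction with
  | base => simp
  | succ k hk ih =>
    have h₁ := pulls_succ H i ⟨k, hm'⟩
    have h₂ := ih (by omega)
    simp only at h₁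
    split_ifs at h₁ <;> omega

lemma exists_pull {K n : ℕ} (H : History K n) (i : Fin K) {l m : ℕ} (hl : 1 ≤ l) (hm : m ≤ n)
    (hlm : l ≤ pulls H i m) : ∃ s : Fin n, (H s).1 = i ∧ pulls H i (s + 1) = l := by
  induction m with
  | zero => rw [pulls_zero] at hlm; omega
  | succ m ih =>
    by_cases h : l ≤ pulls H i m
    · exact ih (by omega) h
    · have h₁ := pulls_succ H i ⟨m, hm⟩
      simp only at h₁
      by_cases ha : (H ⟨m, hm⟩).1 = i
      · rw [if_pos ha] at h₁
        exact ⟨⟨m, hm⟩, ha, by simp only; omega⟩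
      · rw [if_neg ha] at h₁
        omega

/-- The payoff of arm `i` at the round of its `l`-th pull: the mean of `pullReward`. -/
def pullMean {K n : ℕ} (μ : Fin K → ℕ → ℝ) (H : History K n) (i : Fin K) (l : ℕ) : ℝ :=
  ∑ s : Fin n, if (H s).1 = i ∧ pulls H i (s + 1) = l then μ i (s + 1) else 0

/-- The rounds `τ l` of the successive pulls of arm `i`. -/
lemma exists_pullTime {K n : ℕ} (H : History K n) (i : Fin K) (μ : Fin K → ℕ → ℝ) :
    ∃ τ : ℕ → ℕ, (∀ l, 1 ≤ l → l ≤ pulls H i n →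
        l ≤ τ l ∧ τ l ≤ n ∧ pullMean μ H i l = μ i (τ l)) ∧
      ∀ l l', 1 ≤ l → l ≤ l' → l' ≤ pulls H i n → τ l + (l' - l) ≤ τ l' := by
  have hex (l : ℕ) : ∃ t : ℕ, 1 ≤ l → l ≤ pulls H i n →
      ∃ s : Fin n, t = s + 1 ∧ (H s).1 = i ∧ pulls H i (s + 1) = l := by
    by_cases hl : 1 ≤ l ∧ l ≤ pulls H i n
    · obtain ⟨s, hs⟩ := exists_pull H i hl.1 le_rfl hl.2
      exact ⟨s + 1, fun _ _ => ⟨s, rfl, hs⟩⟩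
    · exact ⟨0, fun h h' => absurd ⟨h, h'⟩ hl⟩
  choose τ hτ using hex
  have hprev (s : Fin n) (hs : (H s).1 = i) : pulls H i (s + 1) = pulls H i s + 1 := by
    rw [pulls_succ, if_pos hs]
  have hlt (s s' : Fin n) (hs' : (H s').1 = i)
      (hp : pulls H i (s + 1) ≤ pulls H i (s' + 1)) : (s : ℕ) + 1 ≤ s' + 1 ∨
        (H s).1 ≠ i := by
    by_contra! hcon
    have h₁ := hprev s hcon.2
    have h₂ := pulls_mono H i (show (s' : ℕ) + 1 ≤ s by omega)
    omega
  refine ⟨τ, fun l hl hl' => ?_, fun l l' hl hll hl' => ?_⟩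
  · obtain ⟨s, h₁, h₂, h₃⟩ := hτ l hl hl'
    refine ⟨?_, by omega, ?_⟩
    · have := pulls_le_add H i (Nat.zero_le (s + 1 : ℕ)) s.2
      rw [pulls_zero] at this
      omega
    · rw [pullMean, Finset.sum_eq_single s, if_pos ⟨h₂, h₃⟩, h₁]
      · intro u _ hu
        refine if_neg fun hu' => hu (Fin.ext ?_)
        rcases hlt s u hu'.1 (by omega) with h | h
        · rcases hlt u s h₂ (by omega) with h' | h'
          · omega
          · exact absurd hu'.1 h'
        · exact absurd h₂ h
      · simp
  · obtain ⟨s, h₁, h₂, h₃⟩ := hτ l hl (hll.trans hl')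
    obtain ⟨s', h₁', h₂', h₃'⟩ := hτ l' (hl.trans hll) hl'
    have hle : (s : ℕ) + 1 ≤ s' + 1 := (hlt s s' h₂' (by omega)).resolve_right (not_not.2 h₂)
    have := pulls_le_add H i hle s'.2
    omega

/-! ### The windowed estimator -/

/-- The value that the windowed estimator at round `t` extracts from a sequence `x`, indexed by
pull number, after `N` pulls and with window `h`. -/
noncomputable def windowEstimate (t : ℝ) (N h : ℕ) (x : ℕ → ℝ) : ℝ :=
  (1 / (h : ℝ)) * ∑ l ∈ Finset.Icc (N - h + 1) N, (x l + (t - l) * ((x l - x (l - h)) / h))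

/-- The weight of `x l` in `windowEstimate t N h x`. -/
noncomputable def windowWeight (t : ℝ) (N h l : ℕ) : ℝ :=
  if N < l then 0
  else if N < l + h then (1 + (t - l) / h) / h
  else if N < l + 2 * h then -((t - (l + h : ℕ)) / h / h)
  else 0

lemma sum_Icc_window (m h : ℕ) (f : ℕ → ℝ) :
    ∑ l ∈ Finset.Icc (m + h + h - h + 1) (m + h + h), f l =
      ∑ j ∈ Finset.range h, f (m + h + j + 1) := by
  rw [show m + h + h - h + 1 = m + h + 1 by omega, ← Finset.Ico_succ_right_eq_Icc,
    Finset.sum_Ico_eq_sum_range, Order.succ_eq_add_one,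
    show m + h + h + 1 - (m + h + 1) = h by omega]
  exact Finset.sum_congr rfl fun j _ => by congr 1; omega

/-- Sums over `windowWeight` split into the older and the newer half of the last `2 h` pulls. Taking
`F a l = a * x l` gives the estimator, and `F a l = a ^ 2` the variance of its noise. -/
lemma sum_windowWeight (t : ℝ) (m h : ℕ) (F : ℝ → ℕ → ℝ) (hF : ∀ l, F 0 l = 0) :
    ∑ l ∈ Finset.range (m + h + h), F (windowWeight t (m + h + h) h (l + 1)) (l + 1) =
      ∑ j ∈ Finset.range h,
        (F (-((t - (m + h + j + 1 : ℕ)) / h / h)) (m + j + 1) +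
          F ((1 + (t - (m + h + j + 1 : ℕ)) / h) / h) (m + h + j + 1)) := by
  rw [Finset.sum_range_add, Finset.sum_range_add, Finset.sum_add_distrib]
  have h₁ : ∑ l ∈ Finset.range m, F (windowWeight t (m + h + h) h (l + 1)) (l + 1) = 0 := by
    refine Finset.sum_eq_zero fun l hl => ?_
    rw [Finset.mem_range] at hl
    rw [windowWeight, if_neg (by omega), if_neg (by omega), if_neg (by omega), hF]
  rw [h₁, zero_add]
  congr 1
  · refine Finset.sum_congr rfl fun j hj => ?_
    rw [Finset.mem_range] at hj
    rw [windowWeight, if_neg (by omega), if_neg (by omega), if_pos (by omega),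
      show m + j + 1 + h = m + h + j + 1 by omega]
  · refine Finset.sum_congr rfl fun j hj => ?_
    rw [Finset.mem_range] at hj
    rw [windowWeight, if_neg (by omega), if_pos (by omega)]

lemma windowEstimate_eq_sum (t : ℝ) {N h : ℕ} (hh : 2 * h ≤ N) (x : ℕ → ℝ) :
    windowEstimate t N h x = ∑ l ∈ Finset.range N, windowWeight t N h (l + 1) * x (l + 1) := by
  obtain ⟨m, rfl⟩ : ∃ m, N = m + h + h := ⟨N - 2 * h, by omega⟩
  rw [sum_windowWeight t m h (fun a l => a * x l) (by simp), windowEstimate, sum_Icc_window,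
    Finset.mul_sum]
  refine Finset.sum_congr rfl fun j _ => ?_
  rw [show m + h + j + 1 - h = m + j + 1 by omega]
  ring

/-- The squared weights of the estimator add up to at most `5 a² / h³`, where
`a = t - N + h - 1` is the largest extrapolation distance. -/
lemma sum_windowWeight_sq_le {t : ℝ} {n N h : ℕ} (hh : 1 ≤ h) (hN : 2 * h ≤ N) (hn : N ≤ n)
    (ht : (N : ℝ) + 1 ≤ t) :
    ∑ l ∈ Finset.range n, windowWeight t N h (l + 1) ^ 2 ≤
      5 * (t - N + h - 1) ^ 2 / (h : ℝ) ^ 3 := by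
  have hzero : ∑ l ∈ Finset.range n, windowWeight t N h (l + 1) ^ 2 =
      ∑ l ∈ Finset.range N, windowWeight t N h (l + 1) ^ 2 := by
    refine (Finset.sum_subset (Finset.range_mono hn) fun l _ hl => ?_).symm
    rw [Finset.mem_range, not_lt] at hl
    rw [windowWeight, if_pos (by omega)]
    simp
  rw [hzero]
  clear hzero hn
  obtain ⟨m, rfl⟩ : ∃ m, N = m + h + h := ⟨N - 2 * h, by omega⟩
  have hh' : (1 : ℝ) ≤ h := by exact_mod_cast hh
  rw [sum_windowWeight t m h (fun a _ => a ^ 2) (by simp)]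
  push_cast at ht ⊢
  set a : ℝ := t - (m + h + h) + h - 1 with ha
  have hah : (h : ℝ) ≤ a := by rw [ha]; linarith
  have hterm (j : ℕ) (hj : j ∈ Finset.range h) :
      (-((t - (m + h + j + 1)) / h / h)) ^ 2 + ((1 + (t - (m + h + j + 1)) / h) / h) ^ 2 ≤
        5 * a ^ 2 / (h : ℝ) ^ 4 := by
    rw [Finset.mem_range] at hj
    have hj' : (j : ℝ) + 1 ≤ h := by exact_mod_cast hj
    have hj0 : (0 : ℝ) ≤ j := Nat.cast_nonneg j
    set b : ℝ := t - (m + h + j + 1) with hb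
    have hb0 : 0 ≤ b := by rw [hb]; linarith
    have hba : b ≤ a := by rw [hb, ha]; linarith
    have heq : (-(b / h / h)) ^ 2 + ((1 + b / h) / h) ^ 2 = (b ^ 2 + (h + b) ^ 2) / (h : ℝ) ^ 4 := by
      field_simp
    rw [heq]
    gcongr
    nlinarith
  calc _ ≤ ∑ _j ∈ Finset.range h, 5 * a ^ 2 / (h : ℝ) ^ 4 := Finset.sum_le_sum hterm
    _ = 5 * a ^ 2 / (h : ℝ) ^ 3 := by
      rw [Finset.sum_const, Finset.card_range, nsmul_eq_mul]
      field_simp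

/-- The error of the estimator with respect to the same expression in the payoffs. -/
lemma windowEstimate_sub {K n : ℕ} (μ : Fin K → ℕ → ℝ) (H : History K n) (i : Fin K) (t : ℝ)
    {h : ℕ} (hh : 2 * h ≤ pulls H i n) :
    windowEstimate t (pulls H i n) h (pullReward H i) -
      windowEstimate t (pulls H i n) h (pullMean μ H i) =
      noiseSum μ i (windowWeight t (pulls H i n) h) H := by
  rw [windowEstimate_eq_sum t hh, windowEstimate_eq_sum t hh, ← Finset.sum_sub_distrib, noiseSum]
  have hterm (l : ℕ) : windowWeight t (pulls H i n) h (l + 1) * pullReward H i (l + 1) -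
      windowWeight t (pulls H i n) h (l + 1) * pullMean μ H i (l + 1) =
      ∑ s : Fin n, if (H s).1 = i ∧ pulls H i (s + 1) = l + 1 then
        windowWeight t (pulls H i n) h (l + 1) * ((H s).2 - μ i (s + 1)) else 0 := by
    rw [← mul_sub, pullReward, pullMean, ← Finset.sum_sub_distrib, Finset.mul_sum]
    refine Finset.sum_congr rfl fun s _ => ?_
    split_ifs <;> simp
  simp_rw [hterm]
  rw [Finset.sum_comm]
  refine Finset.sum_congr rfl fun s _ => ?_
  by_cases hs : (H s).1 = i
  · have hp : pulls H i (s + 1) = pulls H i s + 1 := by rw [pulls_succ, if_pos hs]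
    have hlt : pulls H i s < pulls H i n := by
      have := pulls_mono H i (show (s : ℕ) + 1 ≤ n from s.2)
      omega
    simp only [hs, true_and, if_true, hp, Nat.add_right_cancel_iff]
    rw [Finset.sum_ite_eq, if_pos (Finset.mem_range.2 hlt)]
  · simp [hs]

/-! ### Rising concave payoffs -/

/-- The increment of arm `i`, continued by `0` from round `T` on. -/
def slope {K : ℕ} (T : ℕ) (μ : Fin K → ℕ → ℝ) (i : Fin K) (t : ℕ) : ℝ :=
  if t < T then increment μ i t else 0

section Payoff

variable {K T : ℕ} {σ : ℝ} {ν : Bandit K} {μ : Fin K → ℕ → ℝ}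

lemma slope_nonneg (hν : IsRisingRestless T σ ν μ) (i : Fin K) {t : ℕ} (ht : 1 ≤ t) :
    0 ≤ slope T μ i t := by
  rw [slope]
  split_ifs with h
  · exact hν.nonDecreasing i t ht h
  · exact le_rfl

lemma slope_anti (hν : IsRisingRestless T σ ν μ) (i : Fin K) {t t' : ℕ} (ht : 1 ≤ t)
    (htt : t ≤ t') : slope T μ i t' ≤ slope T μ i t := by
  induction t', htt using Nat.le_induction with
  | base => exact le_rfl
  | succ k hk ih =>
    refine le_trans ?_ ih
    by_cases h : k + 1 < T
    · rw [slope, slope, if_pos h, if_pos (by omega)]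
      exact hν.concave i k (by omega) h
    · rw [slope, if_neg h]
      exact slope_nonneg hν i (by omega)

lemma sub_eq_sum_slope (i : Fin K) {a b : ℕ} (hab : a ≤ b) (hb : b ≤ T) :
    μ i b - μ i a = ∑ l ∈ Finset.Ico a b, slope T μ i l := by
  induction b, hab using Nat.le_induction with
  | base => simp
  | succ k hk ih =>
    rw [Finset.sum_Ico_succ_top hk, ← ih (by omega), slope, if_pos (by omega), increment]
    ring

lemma sub_le_mul_slope (hν : IsRisingRestless T σ ν μ) (i : Fin K) {a b : ℕ} (ha : 1 ≤ a)
    (hab : a ≤ b) (hb : b ≤ T) : μ i b - μ i a ≤ ((b : ℝ) - a) * slope T μ i a := by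
  rw [sub_eq_sum_slope i hab hb, ← Nat.cast_sub hab, ← nsmul_eq_mul, ← Nat.card_Ico]
  exact Finset.sum_le_card_nsmul _ _ _ fun l hl =>
    slope_anti hν i ha (Finset.mem_Ico.1 hl).1

lemma mul_slope_le_sub (hν : IsRisingRestless T σ ν μ) (i : Fin K) {a b : ℕ} (ha : 1 ≤ a)
    (hab : a ≤ b) (hb : b ≤ T) : ((b : ℝ) - a) * slope T μ i b ≤ μ i b - μ i a := by
  rw [sub_eq_sum_slope i hab hb, ← Nat.cast_sub hab, ← nsmul_eq_mul, ← Nat.card_Ico]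
  exact Finset.card_nsmul_le_sum _ _ _ fun l hl =>
    slope_anti hν i (ha.trans (Finset.mem_Ico.1 hl).1) (Finset.mem_Ico.1 hl).2.le

lemma le_windowEstimate {t : ℝ} {N h : ℕ} (hh : 1 ≤ h) (hN : 2 * h ≤ N) {x : ℕ → ℝ} {y : ℝ}
    (hx : ∀ l, N - h + 1 ≤ l → l ≤ N → y ≤ x l + (t - l) * ((x l - x (l - h)) / h)) :
    y ≤ windowEstimate t N h x := by
  have hh' : (0 : ℝ) < h := by exact_mod_cast hh
  have := Finset.card_nsmul_le_sum (Finset.Icc (N - h + 1) N) _ y fun l hl =>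
    hx l (Finset.mem_Icc.1 hl).1 (Finset.mem_Icc.1 hl).2
  rw [Nat.card_Icc, show N + 1 - (N - h + 1) = h by omega, nsmul_eq_mul] at this
  rw [windowEstimate, one_div, ← div_eq_inv_mul, le_div_iff₀ hh', mul_comm]
  exact this

lemma windowEstimate_le {t : ℝ} {N h : ℕ} (hh : 1 ≤ h) (hN : 2 * h ≤ N) {x : ℕ → ℝ} {y : ℝ}
    (hx : ∀ l, N - h + 1 ≤ l → l ≤ N → x l + (t - l) * ((x l - x (l - h)) / h) ≤ y) :
    windowEstimate t N h x ≤ y := by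
  have hh' : (0 : ℝ) < h := by exact_mod_cast hh
  have := Finset.sum_le_card_nsmul (Finset.Icc (N - h + 1) N) _ y fun l hl =>
    hx l (Finset.mem_Icc.1 hl).1 (Finset.mem_Icc.1 hl).2
  rw [Nat.card_Icc, show N + 1 - (N - h + 1) = h by omega, nsmul_eq_mul] at this
  rw [windowEstimate, one_div, ← div_eq_inv_mul, div_le_iff₀ hh', mul_comm]
  exact this

/-- The noiseless estimator is optimistic: by concavity the payoff at round `n + 1` lies below
the secant through two earlier pulls. -/
lemma le_windowEstimate_pullMean (hν : IsRisingRestless T σ ν μ) {n : ℕ} (hn : n < T)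
    (H : History K n) (i : Fin K) {h : ℕ} (hh : 1 ≤ h) (hN : 2 * h ≤ pulls H i n) :
    μ i (n + 1) ≤ windowEstimate ((n : ℝ) + 1) (pulls H i n) h (pullMean μ H i) := by
  obtain ⟨τ, hτ, hτ'⟩ := exists_pullTime H i μ
  have hh' : (0 : ℝ) < h := by exact_mod_cast hh
  refine le_windowEstimate hh hN fun l hl hl' => ?_
  obtain ⟨h₁, h₂, h₃⟩ := hτ l (by omega) hl'
  obtain ⟨h₁', h₂', h₃'⟩ := hτ (l - h) (by omega) (by omega)
  have h₄ := hτ' (l - h) l (by omega) (by omega) hl'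
  rw [h₃, h₃']
  have hrise := sub_le_mul_slope hν i (a := τ l) (b := n + 1) (by omega) (by omega) hn
  have hslope := mul_slope_le_sub hν i (a := τ (l - h)) (b := τ l) (by omega) (by omega) (by omega)
  have hs0 := slope_nonneg hν i (t := τ l) (by omega)
  push_cast at hrise
  have hgap : (h : ℝ) ≤ (τ l : ℝ) - τ (l - h) := by
    have : τ (l - h) + h ≤ τ l := by omega
    have : (τ (l - h) : ℝ) + h ≤ τ l := by exact_mod_cast this
    linarith
  have hlτ : (l : ℝ) ≤ τ l := by exact_mod_cast h₁
  have hτn : (τ l : ℝ) ≤ n := by exact_mod_cast h₂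
  have hsec : slope T μ i (τ l) ≤ (μ i (τ l) - μ i (τ (l - h))) / h := by
    rw [le_div_iff₀ hh', mul_comm]
    exact (mul_le_mul_of_nonneg_right hgap hs0).trans hslope
  have hmul : ((n : ℝ) + 1 - τ l) * slope T μ i (τ l) ≤
      ((n : ℝ) + 1 - l) * ((μ i (τ l) - μ i (τ (l - h))) / h) :=
    mul_le_mul (by linarith) hsec hs0 (by linarith)
  linarith

/-- The bias of the noiseless estimator is governed by the increment at any round `k` that is at most
the number `N - 2 h + 1` of the first pull that enters the estimator, hence at most its round. -/
lemma windowEstimate_pullMean_le (hν : IsRisingRestless T σ ν μ) {n : ℕ} (hn : n < T)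
    (H : History K n) (i : Fin K) {h k : ℕ} (hh : 1 ≤ h) (hN : 2 * h ≤ pulls H i n) (hk : 1 ≤ k)
    (hkN : k + 2 * h ≤ pulls H i n + 1) :
    windowEstimate ((n : ℝ) + 1) (pulls H i n) h (pullMean μ H i) ≤
      μ i (n + 1) + (T : ℝ) ^ 2 * slope T μ i k / h := by
  obtain ⟨τ, hτ, hτ'⟩ := exists_pullTime H i μ
  have hh' : (0 : ℝ) < h := by exact_mod_cast hh
  refine windowEstimate_le hh hN fun l hl hl' => ?_
  obtain ⟨h₁, h₂, h₃⟩ := hτ l (by omega) hl'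
  obtain ⟨h₁', h₂', h₃'⟩ := hτ (l - h) (by omega) (by omega)
  have h₄ := hτ' (l - h) l (by omega) (by omega) hl'
  rw [h₃, h₃']
  have hrise := mul_slope_le_sub hν i (a := τ l) (b := n + 1) (by omega) (by omega) hn
  have hs1 := slope_nonneg hν i (t := n + 1) (by omega)
  have hslope := sub_le_mul_slope hν i (a := τ (l - h)) (b := τ l) (by omega) (by omega) (by omega)
  have hsk : slope T μ i (τ (l - h)) ≤ slope T μ i k := slope_anti hν i hk (by omega)
  have hs0 := slope_nonneg hν i hk
  push_cast at hrise
  have hτn : (τ l : ℝ) ≤ n := by exact_mod_cast h₂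
  have hτ0 : (0 : ℝ) ≤ τ (l - h) := Nat.cast_nonneg _
  have hττ : (τ (l - h) : ℝ) ≤ τ l := by exact_mod_cast (by omega : τ (l - h) ≤ τ l)
  have hnT : (n : ℝ) + 1 ≤ T := by exact_mod_cast hn
  have hl0 : (0 : ℝ) ≤ l := Nat.cast_nonneg _
  have hln : (l : ℝ) ≤ n := by exact_mod_cast h₁.trans h₂
  have hμ : μ i (τ l) ≤ μ i (n + 1) := by
    have := mul_nonneg (show (0 : ℝ) ≤ n + 1 - τ l by linarith) hs1
    linarith
  have hd : (μ i (τ l) - μ i (τ (l - h))) / h ≤ T * slope T μ i k / h := by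
    gcongr
    refine hslope.trans ?_
    exact mul_le_mul (by linarith) hsk (slope_nonneg hν i (by omega)) (by positivity)
  have hmul : ((n : ℝ) + 1 - l) * ((μ i (τ l) - μ i (τ (l - h))) / h) ≤
      T * (T * slope T μ i k / h) := by
    refine (mul_le_mul_of_nonneg_left hd (by linarith)).trans ?_
    gcongr
    linarith
  have : (T : ℝ) * (T * slope T μ i k / h) = T ^ 2 * slope T μ i k / h := by ring
  linarith

end Payoff

/-! ### Sums over pull numbers -/

/-- Each value of `n ↦ ⌊c n⌋` is taken at most `1 / c + 1` times. -/
lemma sum_floor_mul_le {c : ℝ} (hc : 0 < c) {F : ℕ → ℝ} (hF : ∀ j, 0 ≤ F j) (N : ℕ) :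
    ∑ n ∈ Finset.range N, F ⌊c * n⌋₊ ≤ (1 / c + 1) * ∑ j ∈ Finset.range (⌊c * N⌋₊ + 1), F j := by
  have hmaps : ∀ n ∈ Finset.range N, ⌊c * n⌋₊ ∈ Finset.range (⌊c * N⌋₊ + 1) := by
    intro n hn
    rw [Finset.mem_range] at hn ⊢
    refine Nat.lt_succ_of_le (Nat.floor_mono ?_)
    gcongr
  rw [← Finset.sum_fiberwise_of_maps_to hmaps, Finset.mul_sum]
  refine Finset.sum_le_sum fun j _ => ?_
  have hcard : (((Finset.range N).filter fun n : ℕ => ⌊c * (n : ℝ)⌋₊ = j).card : ℝ) ≤ 1 / c + 1 := by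
    have hsub : ((Finset.range N).filter fun n : ℕ => ⌊c * (n : ℝ)⌋₊ = j) ⊆
        Finset.Ico ⌈(j : ℝ) / c⌉₊ ⌈((j : ℝ) + 1) / c⌉₊ := by
      intro n hn
      rw [Finset.mem_filter, Nat.floor_eq_iff (by positivity)] at hn
      rw [Finset.mem_Ico, Nat.ceil_le, Nat.lt_ceil, div_le_iff₀ hc, lt_div_iff₀ hc, mul_comm]
      exact hn.2
    have h₁ := Finset.card_le_card hsub
    rw [Nat.card_Ico] at h₁
    have h₂ : ⌈(j : ℝ) / c⌉₊ ≤ ⌈((j : ℝ) + 1) / c⌉₊ := Nat.ceil_mono (by gcongr; linarith)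
    have h₃ := Nat.ceil_lt_add_one (show 0 ≤ ((j : ℝ) + 1) / c by positivity)
    have h₄ := Nat.le_ceil ((j : ℝ) / c)
    have h₅ : (((Finset.range N).filter fun n : ℕ => ⌊c * (n : ℝ)⌋₊ = j).card : ℝ) ≤
        (⌈((j : ℝ) + 1) / c⌉₊ : ℝ) - ⌈(j : ℝ) / c⌉₊ := by
      rw [← Nat.cast_sub h₂]; exact_mod_cast h₁
    have h₆ : ((j : ℝ) + 1) / c = j / c + 1 / c := by ring
    linarith
  calc ∑ n ∈ (Finset.range N).filter fun n : ℕ => ⌊c * (n : ℝ)⌋₊ = j, F ⌊c * n⌋₊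
      = ((Finset.range N).filter fun n : ℕ => ⌊c * (n : ℝ)⌋₊ = j).card * F j := by
        rw [← nsmul_eq_mul, ← Finset.sum_const]
        exact Finset.sum_congr rfl fun n hn => by rw [(Finset.mem_filter.1 hn).2]
    _ ≤ (1 / c + 1) * F j := mul_le_mul_of_nonneg_right hcard (hF j)

/-- A truncated series of exponent `3 / 2`: the terms with `h ≤ B` are bounded by `1`, the
others telescope. The term `h = 0` is `0`, since it divides by `0`. -/
lemma sum_min_one_sqrt_le {B : ℝ} (hB : 0 < B) (M : ℕ) :
    ∑ h ∈ Finset.range M, min 1 (√(B ^ 3 / (h : ℝ) ^ 3)) ≤ 3 * B + 1 := by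
  set m : ℕ := ⌈B⌉₊ with hm
  have hm1 : 1 ≤ m := Nat.ceil_pos.2 hB
  have hmB : (m : ℝ) < B + 1 := Nat.ceil_lt_add_one hB.le
  have hBm : B ≤ m := Nat.le_ceil B
  have hmono (N : ℕ) (hN : m ≤ N) : ∑ h ∈ Finset.range (N + 1), min 1 (√(B ^ 3 / (h : ℝ) ^ 3)) ≤
      m + 2 * √(B ^ 3) * (1 / √m - 1 / √N) := by
    induction N, hN using Nat.le_induction with
    | base =>
      rw [Finset.sum_range_succ']
      have : ∑ k ∈ Finset.range m, min 1 (√(B ^ 3 / ((k + 1 : ℕ) : ℝ) ^ 3)) ≤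
          (Finset.range m).card • (1 : ℝ) := Finset.sum_le_card_nsmul _ _ _ fun _ _ => min_le_left _ _
      simpa using this
    | succ N hN ih =>
      rw [Finset.sum_range_succ]
      have hN0 : (0 : ℝ) < N := by exact_mod_cast (by omega : 0 < N)
      set u := √(N : ℝ) with hu
      set v := √((N + 1 : ℕ) : ℝ) with hv
      have hu0 : 0 < u := Real.sqrt_pos.2 hN0
      have hv0 : 0 < v := Real.sqrt_pos.2 (by positivity)
      have hu2 : u ^ 2 = N := Real.sq_sqrt hN0.le
      have hv2 : v ^ 2 = N + 1 := by rw [hv, Real.sq_sqrt (by positivity)]; push_cast; ring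
      have huv : u ≤ v := Real.sqrt_le_sqrt (by push_cast; linarith)
      have hv3 : √(((N + 1 : ℕ) : ℝ) ^ 3) = v ^ 3 := by
        rw [show ((N + 1 : ℕ) : ℝ) ^ 3 = (v ^ 3) ^ 2 by
          rw [← pow_mul, mul_comm 3 2, pow_mul, hv2]; push_cast; ring]
        exact Real.sqrt_sq (by positivity)
      have hstep : 1 / v ^ 3 ≤ 2 * (1 / u - 1 / v) := by
        have h₁ : (v - u) * (v + u) = 1 := by nlinarith
        have h₂ : 1 ≤ 2 * v * (v - u) := by nlinarith
        have h₃ : 2 * (1 / u - 1 / v) = 2 * (v - u) / (u * v) := by field_simp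
        rw [h₃, div_le_div_iff₀ (by positivity) (by positivity)]
        calc 1 * (u * v) ≤ (2 * v * (v - u)) * (v * v) := by gcongr
          _ = 2 * (v - u) * v ^ 3 := by ring
      have hle : min 1 (√(B ^ 3 / ((N + 1 : ℕ) : ℝ) ^ 3)) ≤ √(B ^ 3) * (2 * (1 / u - 1 / v)) := by
        refine (min_le_right _ _).trans ?_
        rw [Real.sqrt_div (by positivity), hv3, div_eq_mul_one_div]
        gcongr
      linarith
  have hsub : Finset.range M ⊆ Finset.range (max M m + 1) := Finset.range_mono (by omega)
  refine (Finset.sum_le_sum_of_subset_of_nonneg hsub fun _ _ _ => by positivity).trans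
    ((hmono _ (le_max_right _ _)).trans ?_)
  have h₁ : √(B ^ 3) * (1 / √m) ≤ B := by
    have hmpos : (0 : ℝ) < m := hB.trans_le hBm
    rw [mul_one_div, ← Real.sqrt_div (by positivity), Real.sqrt_le_left hB.le,
      div_le_iff₀ hmpos]
    calc B ^ 3 = B ^ 2 * B := by ring
      _ ≤ B ^ 2 * m := by gcongr
  have h₂ : 0 ≤ √(B ^ 3) * (1 / √((max M m : ℕ) : ℝ)) := by positivity
  linarith

lemma sum_inv_le_one_add_log {M T : ℕ} (hMT : M ≤ T) :
    ∑ j ∈ Finset.range (M + 1), (j : ℝ)⁻¹ ≤ 1 + Real.log T := by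
  have h := harmonic_le_one_add_log M
  rw [Finset.sum_range_succ']
  simp only [Nat.cast_zero, inv_zero, add_zero]
  rw [harmonic] at h
  push_cast at h ⊢
  refine h.trans ?_
  rcases Nat.eq_zero_or_pos M with rfl | hM
  · have : (0 : ℝ) ≤ Real.log T := Real.log_natCast_nonneg T
    simpa using this
  · have : Real.log M ≤ Real.log T :=
      Real.log_le_log (by exact_mod_cast hM) (by exact_mod_cast hMT)
    linarith

lemma sum_range_le_of_antitone {g : ℕ → ℝ} (hg : Antitone g) (hg0 : ∀ j, 0 ≤ g j) {m : ℕ}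
    (hm : 1 ≤ m) (m' : ℕ) :
    ∑ j ∈ Finset.range m', g j ≤ (1 + (m' : ℝ) / m) * ∑ j ∈ Finset.range m, g j := by
  have hm0 : (0 : ℝ) < m := by exact_mod_cast hm
  have hG : 0 ≤ ∑ j ∈ Finset.range m, g j := Finset.sum_nonneg fun j _ => hg0 j
  have hmul : m * g m ≤ ∑ j ∈ Finset.range m, g j := by
    have := Finset.card_nsmul_le_sum (Finset.range m) g (g m) fun j hj =>
      hg (Finset.mem_range.1 hj).le
    simpa using this
  have hle : ∑ j ∈ Finset.range m', g j ≤ ∑ j ∈ Finset.range m, g j + m' * g m := by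
    rcases le_total m' m with h | h
    · refine (Finset.sum_le_sum_of_subset_of_nonneg (Finset.range_mono h)
        fun j _ _ => hg0 j).trans (le_add_of_nonneg_right ?_)
      exact mul_nonneg (Nat.cast_nonneg _) (hg0 m)
    · obtain ⟨d, rfl⟩ := Nat.exists_eq_add_of_le h
      rw [Finset.sum_range_add]
      have := Finset.sum_le_card_nsmul (Finset.range d) (fun j => g (m + j)) (g m) fun j _ =>
        hg (Nat.le_add_right m j)
      rw [Finset.card_range, nsmul_eq_mul] at this
      have h' : (d : ℝ) * g m ≤ ((m + d : ℕ) : ℝ) * g m := by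
        gcongr
        · exact hg0 m
        · omega
      linarith
  have hdiv : m' * g m ≤ (m' : ℝ) / m * ∑ j ∈ Finset.range m, g j := by
    rw [div_mul_eq_mul_div, le_div_iff₀ hm0]
    calc (m' : ℝ) * g m * m = m' * (m * g m) := by ring
      _ ≤ _ := by gcongr
  linarith

lemma min_one_le_rpow {x p : ℝ} (hx : 0 ≤ x) (hp : 0 ≤ p) (hp' : p ≤ 1) : min 1 x ≤ x ^ p := by
  rcases le_total x 1 with h | h
  · exact (min_le_right _ _).trans (Real.self_le_rpow_of_le_one hx h hp')
  · exact (min_le_left _ _).trans (Real.one_le_rpow h hp)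

lemma rpow_le_self_of_one_le {x p : ℝ} (hx : 1 ≤ x) (hp' : p ≤ 1) : x ^ p ≤ x := by
  simpa using Real.rpow_le_rpow_of_exponent_le hx hp'

/-- The interpolation behind the exponents of the bias term: `min 1 x ≤ x ^ (q / (1 + q))`,
followed by Hölder's inequality with exponents `(1 + q) / q` and `1 + q`. -/
lemma sum_min_one_mul_le (s : Finset ℕ) {D q : ℝ} (hD : 0 ≤ D) (hq : 0 < q) {a b : ℕ → ℝ}
    (ha : ∀ n, 0 ≤ a n) (hb : ∀ n, 0 ≤ b n) :
    ∑ n ∈ s, min 1 (D * b n * a n) ≤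
      D ^ (q / (1 + q)) * ((∑ n ∈ s, a n) ^ (q / (1 + q)) *
        (∑ n ∈ s, b n ^ q) ^ (1 / (1 + q))) := by
  set p : ℝ := q / (1 + q) with hp
  have hp0 : 0 < p := by positivity
  have hp1 : p ≤ 1 := by rw [hp, div_le_one (by positivity)]; linarith
  have hconj : ((1 + q) / q).HolderConjugate (1 + q) := by
    rw [Real.holderConjugate_iff]
    refine ⟨by rw [lt_div_iff₀ hq]; linarith, ?_⟩
    field_simp
    ring
  have hold := Real.inner_le_Lp_mul_Lq s (fun n => a n ^ p) (fun n => b n ^ p) hconj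
  have h₁ (n : ℕ) : |a n ^ p| ^ ((1 + q) / q) = a n := by
    rw [abs_of_nonneg (Real.rpow_nonneg (ha n) _), ← Real.rpow_mul (ha n), hp,
      show q / (1 + q) * ((1 + q) / q) = 1 by field_simp, Real.rpow_one]
  have h₂ (n : ℕ) : |b n ^ p| ^ (1 + q) = b n ^ q := by
    rw [abs_of_nonneg (Real.rpow_nonneg (hb n) _), ← Real.rpow_mul (hb n), hp,
      show q / (1 + q) * (1 + q) = q by field_simp]
  simp_rw [h₁, h₂] at hold
  rw [show 1 / ((1 + q) / q) = p by rw [hp, one_div_div]] at hold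
  calc ∑ n ∈ s, min 1 (D * b n * a n) ≤ ∑ n ∈ s, D ^ p * (a n ^ p * b n ^ p) := by
        refine Finset.sum_le_sum fun n _ => ?_
        refine (min_one_le_rpow (mul_nonneg (mul_nonneg hD (hb n)) (ha n)) hp0.le hp1).trans_eq ?_
        rw [Real.mul_rpow (mul_nonneg hD (hb n)) (ha n), Real.mul_rpow hD (hb n)]
        ring
    _ = D ^ p * ∑ n ∈ s, a n ^ p * b n ^ p := by rw [Finset.mul_sum]
    _ ≤ _ := by gcongr

/-- The exploration contribution of one arm: pulls with an empty window cost `1`, the others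
their exploration bonus. -/
lemma sum_bonus_le {ε B : ℝ} (hε : 0 < ε) (hε' : ε ≤ 1) (hB : 0 < B) (N : ℕ) :
    ∑ n ∈ Finset.range N, ((if ⌊ε * (n : ℝ)⌋₊ = 0 then (1 : ℝ) else 0) +
      min 1 (√(B ^ 3 / (⌊ε * (n : ℝ)⌋₊ : ℝ) ^ 3))) ≤ 2 / ε * (3 * B + 2) := by
  have h := sum_floor_mul_le hε (F := fun h => (if h = 0 then (1 : ℝ) else 0) +
    min 1 (√(B ^ 3 / (h : ℝ) ^ 3))) (fun j => by positivity) N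
  refine h.trans ?_
  have hone : 1 ≤ 1 / ε := by rw [le_div_iff₀ hε]; linarith
  have h2 : 1 / ε + 1 ≤ 2 / ε := by
    have : 2 / ε = 1 / ε + 1 / ε := by ring
    linarith
  rw [Finset.sum_add_distrib, Finset.sum_ite_eq' (Finset.range (⌊ε * (N : ℝ)⌋₊ + 1)) 0,
    if_pos (by simp)]
  have h3 := sum_min_one_sqrt_le hB (⌊ε * (N : ℝ)⌋₊ + 1)
  exact mul_le_mul h2 (by linarith) (by positivity) (by positivity)

/-- The bias contribution of one arm that is pulled `N` times. -/
lemma sum_bias_le {ε q : ℝ} (hε : 0 < ε) (hε' : ε < 1 / 2) (hq : 0 < q) {T : ℕ}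
    (hT : 1 ≤ Real.log T) {γ g : ℕ → ℝ} (hγ : ∀ j, 0 ≤ γ j) (hg0 : ∀ j, 0 ≤ g j)
    (hg : Antitone g) (hγg : ∀ j, γ j ^ q ≤ g j) {N m : ℕ} (hN : N ≤ T) (hm : 1 ≤ m) :
    ∑ n ∈ Finset.range N, min 1 ((T : ℝ) ^ 2 * γ ⌊(1 - 2 * ε) * (n : ℝ)⌋₊ / ⌊ε * (n : ℝ)⌋₊) ≤
      8 * ((T : ℝ) ^ (2 * q / (1 + q)) * Real.log T ^ (q / (1 + q)) / (ε * (1 - 2 * ε)) *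
        (∑ j ∈ Finset.range m, g j) ^ (1 / (1 + q))) *
          (1 + ((1 - 2 * ε) * N + 1) / m) := by
  set c : ℝ := 1 - 2 * ε with hc
  have hc0 : 0 < c := by rw [hc]; linarith
  have hc1 : c ≤ 1 := by rw [hc]; linarith
  have hm0 : (0 : ℝ) < m := by exact_mod_cast hm
  set p : ℝ := q / (1 + q) with hp
  set r : ℝ := 1 / (1 + q) with hr
  have hp1 : p ≤ 1 := by rw [hp, div_le_one (by positivity)]; linarith
  have hr0 : 0 < r := by positivity
  have hr1 : r ≤ 1 := by rw [hr, div_le_one (by positivity)]; linarith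
  have hhold := sum_min_one_mul_le (Finset.range N) (D := (T : ℝ) ^ 2) (by positivity) hq
    (a := fun n => ((⌊ε * (n : ℝ)⌋₊ : ℕ) : ℝ)⁻¹) (b := fun n => γ ⌊c * (n : ℝ)⌋₊)
    (fun n => by positivity) (fun n => hγ _)
  simp only [← div_eq_mul_inv] at hhold
  refine hhold.trans ?_
  -- the harmonic factor
  have ha : ∑ n ∈ Finset.range N, ((⌊ε * (n : ℝ)⌋₊ : ℕ) : ℝ)⁻¹ ≤ 4 / ε * Real.log T := by
    refine (sum_floor_mul_le hε (F := fun h => (h : ℝ)⁻¹) (fun j => by positivity) N).trans ?_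
    have hfl : ⌊ε * (N : ℝ)⌋₊ ≤ T := by
      refine le_trans ?_ hN
      refine (Nat.floor_mono (mul_le_of_le_one_left (Nat.cast_nonneg N) (by linarith))).trans_eq ?_
      exact Nat.floor_natCast N
    have h₁ := sum_inv_le_one_add_log hfl
    have h₂ : 1 / ε + 1 ≤ 2 / ε := by
      have h : 1 ≤ 1 / ε := by rw [le_div_iff₀ hε]; linarith
      have : 2 / ε = 1 / ε + 1 / ε := by ring
      linarith
    calc _ ≤ 2 / ε * (2 * Real.log T) := by gcongr; linarith
      _ = _ := by ring
  have hap : (∑ n ∈ Finset.range N, ((⌊ε * (n : ℝ)⌋₊ : ℕ) : ℝ)⁻¹) ^ p ≤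
      4 / ε * Real.log T ^ p := by
    calc _ ≤ (4 / ε * Real.log T) ^ p := by gcongr
      _ = (4 / ε) ^ p * Real.log T ^ p := Real.mul_rpow (by positivity) (by linarith)
      _ ≤ _ := by
        gcongr
        refine rpow_le_self_of_one_le ?_ hp1
        rw [le_div_iff₀ hε]; linarith
  -- the factor with the increments
  have hb : ∑ n ∈ Finset.range N, γ ⌊c * (n : ℝ)⌋₊ ^ q ≤
      2 / c * (1 + (c * N + 1) / m) * ∑ j ∈ Finset.range m, g j := by
    have h₂ : 1 / c + 1 ≤ 2 / c := by
      have h : 1 ≤ 1 / c := by rw [le_div_iff₀ hc0]; linarith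
      have : 2 / c = 1 / c + 1 / c := by ring
      linarith
    have h₃ : ((⌊c * (N : ℝ)⌋₊ + 1 : ℕ) : ℝ) ≤ c * N + 1 := by
      have := Nat.floor_le (show 0 ≤ c * (N : ℝ) by positivity)
      push_cast; linarith
    have hG : 0 ≤ ∑ j ∈ Finset.range m, g j := Finset.sum_nonneg fun j _ => hg0 j
    calc _ ≤ ∑ n ∈ Finset.range N, g ⌊c * (n : ℝ)⌋₊ := Finset.sum_le_sum fun n _ => hγg _
      _ ≤ (1 / c + 1) * ∑ j ∈ Finset.range (⌊c * (N : ℝ)⌋₊ + 1), g j :=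
        sum_floor_mul_le hc0 hg0 N
      _ ≤ 2 / c * ((1 + ((⌊c * (N : ℝ)⌋₊ + 1 : ℕ) : ℝ) / m) * ∑ j ∈ Finset.range m, g j) := by
        gcongr
        · exact Finset.sum_nonneg fun j _ => hg0 j
        · exact sum_range_le_of_antitone hg hg0 hm _
      _ ≤ 2 / c * ((1 + (c * N + 1) / m) * ∑ j ∈ Finset.range m, g j) := by gcongr
      _ = _ := by ring
  have hbr : (∑ n ∈ Finset.range N, γ ⌊c * (n : ℝ)⌋₊ ^ q) ^ r ≤
      2 / c * (1 + (c * N + 1) / m) * (∑ j ∈ Finset.range m, g j) ^ r := by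
    have hone : 1 ≤ 2 / c * (1 + (c * N + 1) / m) := by
      refine one_le_mul_of_one_le_of_one_le ?_ ?_
      · rw [le_div_iff₀ hc0]; linarith
      · have : 0 ≤ (c * N + 1) / m := by positivity
        linarith
    calc _ ≤ (2 / c * (1 + (c * N + 1) / m) * ∑ j ∈ Finset.range m, g j) ^ r := by
          refine Real.rpow_le_rpow (Finset.sum_nonneg fun n _ => Real.rpow_nonneg (hγ _) _) hb hr0.le
      _ = (2 / c * (1 + (c * N + 1) / m)) ^ r * (∑ j ∈ Finset.range m, g j) ^ r :=
        Real.mul_rpow (by positivity) (Finset.sum_nonneg fun j _ => hg0 j)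
      _ ≤ _ := by
        gcongr
        · exact Real.rpow_nonneg (Finset.sum_nonneg fun j _ => hg0 j) _
        · exact rpow_le_self_of_one_le hone hr1
  have hTp : ((T : ℝ) ^ 2) ^ p = (T : ℝ) ^ (2 * q / (1 + q)) := by
    rw [← Real.rpow_natCast, ← Real.rpow_mul (Nat.cast_nonneg T), hp]
    congr 1
    push_cast
    ring
  have hL : 0 ≤ Real.log T ^ p := Real.rpow_nonneg (by linarith) _
  rw [hTp]
  calc _ ≤ (T : ℝ) ^ (2 * q / (1 + q)) * ((4 / ε * Real.log T ^ p) *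
        (2 / c * (1 + (c * N + 1) / m) * (∑ j ∈ Finset.range m, g j) ^ r)) := by
        gcongr
        exact Real.rpow_nonneg (Finset.sum_nonneg fun n _ => Real.rpow_nonneg (hγ _) _) _
    _ = _ := by
      field_simp
      ring

/-! ### Regret as an expected sum of gaps -/

lemma measurable_arm_comp {K n : ℕ} (f : Fin K → ℝ) (s : Fin n) :
    Measurable fun H : History K n => f (H s).1 :=
  (Measurable.of_discrete (f := f)).comp (measurable_fst.comp (measurable_pi_apply s))

section Payoff

variable {K T : ℕ} {σ : ℝ} {ν : Bandit K} {μ : Fin K → ℕ → ℝ}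

lemma expectedReward_eq (hν : IsRisingRestless T σ ν μ) (π : Policy K) :
    expectedReward ν π T = ∫ H, ∑ s : Fin T, μ (H s).1 (s + 1) ∂(histLaw ν π T) := by
  refine integral_congr_ae (Filter.Eventually.of_forall fun H => ?_)
  exact Finset.sum_congr rfl fun s _ => hν.restless _ _ _ ⟨by omega, s.2⟩

lemma integrable_payoff (hν : IsRisingRestless T σ ν μ) (π : Policy K) :
    Integrable (fun H : History K T => ∑ s : Fin T, μ (H s).1 (s + 1)) (histLaw ν π T) := by
  refine integrable_finsetSum _ fun s _ => Integrable.of_bound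
    (measurable_arm_comp (fun i => μ i (s + 1)) s).aestronglyMeasurable 1
    (Filter.Eventually.of_forall fun H => ?_)
  have := hν.bounded (H s).1 (s + 1) ⟨by omega, s.2⟩
  rw [Real.norm_eq_abs, abs_of_nonneg this.1]
  exact this.2

/-- The largest payoff of an arm at round `t`. -/
noncomputable def bestPayoff (μ : Fin K → ℕ → ℝ) (t : ℕ) : ℝ := ⨆ i, μ i t

lemma le_bestPayoff (μ : Fin K → ℕ → ℝ) (i : Fin K) (t : ℕ) : μ i t ≤ bestPayoff μ t :=
  le_ciSup (Set.finite_range fun i => μ i t).bddAbove i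

/-- Without any influence of the pulls on the payoffs, no policy beats the greedy oracle. -/
lemma regret_le_integral (hν : IsRisingRestless T σ ν μ) (π : Policy K) :
    regret ν π T ≤
      ∫ H, ∑ s : Fin T, (bestPayoff μ (s + 1) - μ (H s).1 (s + 1)) ∂(histLaw ν π T) := by
  have hint : ∫ H, ∑ s : Fin T, (bestPayoff μ (s + 1) - μ (H s).1 (s + 1)) ∂(histLaw ν π T) =
      ∑ s : Fin T, bestPayoff μ (s + 1) - expectedReward ν π T := by
    simp_rw [Finset.sum_sub_distrib]
    rw [integral_sub (integrable_const _) (integrable_payoff hν π), expectedReward_eq hν π]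
    simp
  have : Nonempty (Policy K) := ⟨π⟩
  rw [hint, regret]
  refine sub_le_sub_right (ciSup_le fun π' => ?_) _
  rw [expectedReward_eq hν π']
  calc _ ≤ ∫ _, ∑ s : Fin T, bestPayoff μ (s + 1) ∂(histLaw ν π' T) :=
        integral_mono (integrable_payoff hν π') (integrable_const _) fun H =>
          Finset.sum_le_sum fun s _ => le_bestPayoff μ _ _
    _ = _ := by simp

/-! ### The event that some estimate is far off -/

lemma log_one_div_rpow_neg (n : ℕ) (α : ℝ) :
    Real.log (1 / ((n : ℝ) + 1) ^ (-α)) = α * Real.log (n + 1) := by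
  rw [one_div, Real.log_inv, Real.log_rpow (by positivity)]
  ring

/-- The real value of the exploration bonus at round `n + 1`, for an arm with `N` pulls and the
window `h`. -/
noncomputable def bonusWidth (σ α : ℝ) (n N h : ℕ) : ℝ :=
  σ * ((n : ℝ) + 1 - N + h - 1) * √(10 * (α * Real.log (n + 1)) / (h : ℝ) ^ 3)

/-- The histories of `n` rounds for which an estimate at round `n + 1` misses its mean by more
than its exploration bonus. The number `N` of pulls ranges over all possible values, so that each
of the events united here concerns a sum with deterministic weights. -/
def badEvent (σ ε α : ℝ) (μ : Fin K → ℕ → ℝ) (n : ℕ) : Set (History K n) :=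
  ⋃ i : Fin K, ⋃ N ∈ (Finset.range (n + 1)).filter fun N : ℕ => 1 ≤ ⌊ε * (N : ℝ)⌋₊,
    {H | bonusWidth σ α n N ⌊ε * (N : ℝ)⌋₊ ≤
      |noiseSum μ i (windowWeight ((n : ℝ) + 1) N ⌊ε * (N : ℝ)⌋₊) H|}

lemma measurableSet_badEvent (σ ε α : ℝ) (μ : Fin K → ℕ → ℝ) (n : ℕ) :
    MeasurableSet (badEvent σ ε α μ n) :=
  MeasurableSet.iUnion fun _ => Finset.measurableSet_biUnion _ fun _ _ =>
    measurableSet_le measurable_const (measurable_noiseSum μ _ _).abs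

lemma two_mul_floor_le {ε : ℝ} (hε' : ε < 1 / 2) (N : ℕ) : 2 * ⌊ε * (N : ℝ)⌋₊ ≤ N := by
  have h : ⌊ε * (N : ℝ)⌋₊ ≤ ⌊(N : ℝ) / 2⌋₊ := by
    refine Nat.floor_mono ?_
    have := mul_le_mul_of_nonneg_right hε'.le (Nat.cast_nonneg (α := ℝ) N)
    linarith
  have h₂ : ⌊(N : ℝ) / 2⌋₊ = N / 2 := by simpa using Nat.floor_div_natCast (N : ℝ) 2
  omega

lemma floor_add_two_mul_floor_le {ε : ℝ} (hε : 0 < ε) (hε' : ε < 1 / 2) (N : ℕ) :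
    ⌊(1 - 2 * ε) * (N : ℝ)⌋₊ + 2 * ⌊ε * (N : ℝ)⌋₊ ≤ N := by
  have h₁ := Nat.floor_le (show 0 ≤ ε * (N : ℝ) by positivity)
  have h₂ := Nat.floor_le (show 0 ≤ (1 - 2 * ε) * (N : ℝ) from
    mul_nonneg (by linarith) (Nat.cast_nonneg N))
  have : ((⌊(1 - 2 * ε) * (N : ℝ)⌋₊ + 2 * ⌊ε * (N : ℝ)⌋₊ : ℕ) : ℝ) ≤ N := by
    push_cast; linarith
  exact_mod_cast this

/-- The constant `10` of the exploration bonus is twice the `5` of `sum_windowWeight_sq_le`, so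
that Hoeffding's inequality gives exactly the confidence `(n + 1) ^ (-α)`. -/
lemma histLaw_deviation_le (hσ : 0 < σ) (hν : IsRisingRestless T σ ν μ) (π : Policy K)
    {α : ℝ} (hα : 0 < α) {n N h : ℕ} (hn : n < T) (hh : 1 ≤ h) (hN : 2 * h ≤ N) (hNn : N ≤ n)
    (i : Fin K) :
    histLaw ν π n {H | bonusWidth σ α n N h ≤
        |noiseSum μ i (windowWeight ((n : ℝ) + 1) N h) H|} ≤
      2 * ENNReal.ofReal (((n : ℝ) + 1) ^ (-α)) := by
  have hNn' : (N : ℝ) ≤ n := by exact_mod_cast hNn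
  have hh' : (1 : ℝ) ≤ h := by exact_mod_cast hh
  set a : ℝ := (n : ℝ) + 1 - N + h - 1 with ha
  have ha0 : 0 < a := by rw [ha]; linarith
  have hL : 0 ≤ Real.log ((n : ℝ) + 1) := Real.log_nonneg (by linarith [Nat.cast_nonneg (α := ℝ) n])
  have hb : 0 ≤ bonusWidth σ α n N h := by rw [bonusWidth, ← ha]; positivity
  refine (histLaw_abs_noiseSum_ge_le hσ hν π i _ hn.le (V := 5 * a ^ 2 / (h : ℝ) ^ 3)
    (by positivity) (sum_windowWeight_sq_le hh hN hNn (by linarith)) hb).trans_eq ?_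
  have hexp : -bonusWidth σ α n N h ^ 2 / (2 * (σ ^ 2 * (5 * a ^ 2 / (h : ℝ) ^ 3))) =
      Real.log ((n : ℝ) + 1) * (-α) := by
    rw [bonusWidth, ← ha, mul_pow, Real.sq_sqrt (by positivity)]
    field_simp
    ring
  rw [hexp, ← Real.rpow_def_of_pos (by positivity)]

lemma histLaw_badEvent_le (hσ : 0 < σ) (hν : IsRisingRestless T σ ν μ) (π : Policy K)
    {ε α : ℝ} (hε' : ε < 1 / 2) (hα : 0 < α) {n : ℕ} (hn : n < T) :
    (histLaw ν π n).real (badEvent σ ε α μ n) ≤ 2 * K * ((n : ℝ) + 1) ^ (1 - α) := by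
  have h : histLaw ν π n (badEvent σ ε α μ n) ≤ ∑ _i : Fin K,
      ∑ _N ∈ (Finset.range (n + 1)).filter fun N : ℕ => 1 ≤ ⌊ε * (N : ℝ)⌋₊,
        2 * ENNReal.ofReal (((n : ℝ) + 1) ^ (-α)) := by
    refine (measure_iUnion_fintype_le _ _).trans (Finset.sum_le_sum fun i _ => ?_)
    refine (measure_biUnion_finset_le _ _).trans (Finset.sum_le_sum fun N hN => ?_)
    rw [Finset.mem_filter, Finset.mem_range] at hN
    exact histLaw_deviation_le hσ hν π hα hn hN.2 (two_mul_floor_le hε' N) (by omega) i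
  have h' : histLaw ν π n (badEvent σ ε α μ n) ≤
      ENNReal.ofReal (2 * K * ((n : ℝ) + 1) ^ (1 - α)) := by
    refine h.trans ?_
    rw [Finset.sum_const, Finset.sum_const, Finset.card_fin, nsmul_eq_mul, nsmul_eq_mul]
    have hcard : (((Finset.range (n + 1)).filter fun N : ℕ => 1 ≤ ⌊ε * (N : ℝ)⌋₊).card : ENNReal) ≤
        (n + 1 : ℕ) := by
      exact_mod_cast (Finset.card_filter_le _ _).trans_eq (Finset.card_range _)
    calc _ ≤ (K : ENNReal) * ((n + 1 : ℕ) * (2 * ENNReal.ofReal (((n : ℝ) + 1) ^ (-α)))) := by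
          gcongr
      _ = ENNReal.ofReal (K * ((n + 1 : ℕ) * (2 * ((n : ℝ) + 1) ^ (-α)))) := by
          rw [ENNReal.ofReal_mul (by positivity), ENNReal.ofReal_mul (by positivity),
            ENNReal.ofReal_mul (by positivity)]
          simp only [ENNReal.ofReal_natCast, ENNReal.ofReal_ofNat]
      _ = _ := by
          rw [show (1 : ℝ) - α = 1 + -α by ring, Real.rpow_add (by positivity), Real.rpow_one]
          congr 1
          push_cast
          ring
  exact ENNReal.toReal_le_of_le_ofReal (by positivity) h'

/-! ### The gap at a round outside the bad event -/

lemma index_eq_coe {n : ℕ} {ε : ℝ} (hε' : ε < 1 / 2) (α : ℝ) (H : History K n) (i : Fin K)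
    (hh : 1 ≤ ⌊ε * (pulls H i n : ℝ)⌋₊) :
    index σ ε α H i = ((windowEstimate ((n : ℝ) + 1) (pulls H i n) ⌊ε * (pulls H i n : ℝ)⌋₊
      (pullReward H i) + bonusWidth σ α n (pulls H i n) ⌊ε * (pulls H i n : ℝ)⌋₊ : ℝ) : EReal) := by
  have h2 := two_mul_floor_le hε' (pulls H i n)
  simp only [index, estimator, bonus]
  rw [if_pos ⟨hh, by omega⟩, if_neg (by omega), log_one_div_rpow_neg, EReal.coe_add]
  rfl

lemma index_eq_top {n : ℕ} {ε : ℝ} (α : ℝ) (H : History K n) (i : Fin K)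
    (hh : ⌊ε * (pulls H i n : ℝ)⌋₊ = 0) : index σ ε α H i = ⊤ := by
  simp [index, estimator, bonus, hh]

/-- A bound for the regret of a round in which an arm with `N` earlier pulls is pulled, outside
the bad event: `1` for an empty window, otherwise the bonus and the bias, each truncated at `1`.
For an empty window the last two terms are `0`, since they divide by `0`. -/
noncomputable def gapBound (T : ℕ) (ε B : ℝ) (μ : Fin K → ℕ → ℝ) (i : Fin K) (N : ℕ) : ℝ :=
  ((if ⌊ε * (N : ℝ)⌋₊ = 0 then (1 : ℝ) else 0) +
      min 1 (√(B ^ 3 / (⌊ε * (N : ℝ)⌋₊ : ℝ) ^ 3))) +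
    min 1 ((T : ℝ) ^ 2 * slope T μ i (⌊(1 - 2 * ε) * (N : ℝ)⌋₊ + 1) / ⌊ε * (N : ℝ)⌋₊)

lemma gapBound_nonneg (hν : IsRisingRestless T σ ν μ) (ε B : ℝ) (i : Fin K) (N : ℕ) :
    0 ≤ gapBound T ε B μ i N := by
  have := slope_nonneg hν i (t := ⌊(1 - 2 * ε) * (N : ℝ)⌋₊ + 1) (by omega)
  rw [gapBound]
  positivity

lemma two_mul_bonusWidth_le (hσ : 0 < σ) {α B : ℝ} (hα : 0 < α) {n N h : ℕ} (hn : n < T)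
    (hhN : h ≤ N) (hNn : N ≤ n) (hB : B ^ 3 = 40 * (σ * T) ^ 2 * (α * Real.log T)) :
    2 * bonusWidth σ α n N h ≤ √(B ^ 3 / (h : ℝ) ^ 3) := by
  have hhN' : (h : ℝ) ≤ N := by exact_mod_cast hhN
  have hNn' : (N : ℝ) ≤ n := by exact_mod_cast hNn
  have hnT : (n : ℝ) + 1 ≤ T := by exact_mod_cast hn
  have hn0 : (0 : ℝ) ≤ n := Nat.cast_nonneg n
  have hh0 : (0 : ℝ) ≤ h := Nat.cast_nonneg h
  have hL : 0 ≤ Real.log ((n : ℝ) + 1) := Real.log_nonneg (by linarith)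
  have hLT : Real.log ((n : ℝ) + 1) ≤ Real.log T := Real.log_le_log (by linarith) hnT
  refine Real.le_sqrt_of_sq_le ?_
  rw [bonusWidth, mul_pow, mul_pow, Real.sq_sqrt (by positivity), hB, mul_pow]
  calc (2 : ℝ) ^ 2 * (σ ^ 2 * ((n : ℝ) + 1 - N + h - 1) ^ 2 *
        (10 * (α * Real.log (n + 1)) / (h : ℝ) ^ 3))
      ≤ 2 ^ 2 * (σ ^ 2 * (T : ℝ) ^ 2 * (10 * (α * Real.log T) / (h : ℝ) ^ 3)) := by
        gcongr
        · linarith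
        · linarith
    _ = _ := by ring

/-- The optimism argument: outside the bad event the index of every arm exceeds its payoff, so the
arm of maximal index loses at most its own bias and twice its own bonus. -/
lemma bestPayoff_sub_le_gapBound (hσ : 0 < σ) (hν : IsRisingRestless T σ ν μ) {ε α B : ℝ}
    (hε : 0 < ε) (hε' : ε < 1 / 2) (hα : 0 < α)
    (hB : B ^ 3 = 40 * (σ * T) ^ 2 * (α * Real.log T)) {n : ℕ} (hn : n < T) (H : History K n)
    (hH : H ∉ badEvent σ ε α μ n) (i : Fin K)
    (hi : ∀ j, index σ ε α H j ≤ index σ ε α H i) :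
    bestPayoff μ (n + 1) - μ i (n + 1) ≤ gapBound T ε B μ i (pulls H i n) := by
  have : Nonempty (Fin K) := ⟨i⟩
  have hbd (j : Fin K) := hν.bounded j (n + 1) ⟨by omega, hn⟩
  have hsl := slope_nonneg hν i (t := ⌊(1 - 2 * ε) * (pulls H i n : ℝ)⌋₊ + 1) (by omega)
  rw [sub_le_iff_le_add]
  refine ciSup_le fun j => ?_
  rw [← sub_le_iff_le_add]
  have hone : μ j (n + 1) - μ i (n + 1) ≤ 1 := by linarith [(hbd j).2, (hbd i).1]
  rw [gapBound]
  by_cases hzero : ⌊ε * (pulls H i n : ℝ)⌋₊ = 0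
  · simp only [hzero, if_true]
    have h₁ : (0 : ℝ) ≤ min 1 (√(B ^ 3 / ((0 : ℕ) : ℝ) ^ 3)) := by positivity
    have h₂ : 0 ≤ min 1 ((T : ℝ) ^ 2 *
      slope T μ i (⌊(1 - 2 * ε) * (pulls H i n : ℝ)⌋₊ + 1) / ((0 : ℕ) : ℝ)) := by positivity
    linarith
  rw [if_neg hzero, zero_add]
  have hacc (j : Fin K) (hj : 1 ≤ ⌊ε * (pulls H j n : ℝ)⌋₊) :
      |windowEstimate ((n : ℝ) + 1) (pulls H j n) ⌊ε * (pulls H j n : ℝ)⌋₊ (pullReward H j) -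
        windowEstimate ((n : ℝ) + 1) (pulls H j n) ⌊ε * (pulls H j n : ℝ)⌋₊ (pullMean μ H j)| <
      bonusWidth σ α n (pulls H j n) ⌊ε * (pulls H j n : ℝ)⌋₊ := by
    rw [windowEstimate_sub μ H j _ (two_mul_floor_le hε' _)]
    by_contra! hcon
    refine hH (Set.mem_iUnion.2 ⟨j, Set.mem_iUnion₂.2 ⟨pulls H j n, ?_, hcon⟩⟩)
    rw [Finset.mem_filter, Finset.mem_range]
    exact ⟨Nat.lt_succ_of_le (pulls_le H j n), hj⟩
  have hhi : 1 ≤ ⌊ε * (pulls H i n : ℝ)⌋₊ := by omega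
  have hhj : 1 ≤ ⌊ε * (pulls H j n : ℝ)⌋₊ := by
    by_contra! hcon
    have htop := hi j
    rw [index_eq_top α H j (by omega), index_eq_coe hε' α H i hhi, top_le_iff] at htop
    exact EReal.coe_ne_top _ htop
  have hind := hi j
  rw [index_eq_coe hε' α H i hhi, index_eq_coe hε' α H j hhj, EReal.coe_le_coe_iff] at hind
  have hopt := le_windowEstimate_pullMean hν hn H j hhj (two_mul_floor_le hε' _)
  have hbias := windowEstimate_pullMean_le hν hn H i (k := ⌊(1 - 2 * ε) * (pulls H i n : ℝ)⌋₊ + 1)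
    hhi (two_mul_floor_le hε' _) (by omega)
    (by have := floor_add_two_mul_floor_le hε hε' (pulls H i n); omega)
  have hbon := two_mul_bonusWidth_le hσ hα hn
    (by have := two_mul_floor_le hε' (pulls H i n); omega) (pulls_le H i n) hB (T := T)
    (h := ⌊ε * (pulls H i n : ℝ)⌋₊)
  have hai := abs_lt.1 (hacc i hhi)
  have haj := abs_lt.1 (hacc j hhj)
  set x := (T : ℝ) ^ 2 * slope T μ i (⌊(1 - 2 * ε) * (pulls H i n : ℝ)⌋₊ + 1) /
    ⌊ε * (pulls H i n : ℝ)⌋₊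
  set b := √(B ^ 3 / (⌊ε * (pulls H i n : ℝ)⌋₊ : ℝ) ^ 3)
  have hx : 0 ≤ x := by positivity
  have hb : 0 ≤ b := Real.sqrt_nonneg _
  have hsum : μ j (n + 1) - μ i (n + 1) ≤ b + x := by linarith [hai.2, haj.1]
  rcases le_total 1 b with h | h
  · rw [min_eq_left h]
    have : 0 ≤ min 1 x := by positivity
    linarith
  · rcases le_total 1 x with h' | h'
    · rw [min_eq_left h']
      have : 0 ≤ min 1 b := by positivity
      linarith
    · rw [min_eq_right h, min_eq_right h']
      exact hsum

end Payoff

/-! ### The regret bound -/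

lemma sum_pulls_eq {K n : ℕ} (H : History K n) : ∑ i, pulls H i n = n := by
  simp_rw [pulls_eq_sum]
  rw [Finset.sum_comm]
  simp

section Payoff

variable {K T : ℕ} {σ : ℝ} {ν : Bandit K} {μ : Fin K → ℕ → ℝ}

lemma sum_gapBound_eq (ε B : ℝ) (H : History K T) :
    ∑ s : Fin T, gapBound T ε B μ (H s).1 (pulls H (H s).1 s) =
      ∑ i, ∑ n ∈ Finset.range (pulls H i T), gapBound T ε B μ i n := by
  simp_rw [← sum_pulls]
  rw [Finset.sum_comm]
  simp

/-- A deterministic bound for the accumulated gaps bounds the regret, up to the probability of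
the bad events. -/
lemma regret_le_add_of_sum_gapBound_le (hσ : 0 < σ) (hν : IsRisingRestless T σ ν μ)
    {π : Policy K} {ε α B D : ℝ} (hε : 0 < ε) (hε' : ε < 1 / 2) (hα : 0 < α)
    (hπ : IsRLessUCB T σ ε α π) (hB : B ^ 3 = 40 * (σ * T) ^ 2 * (α * Real.log T))
    (hD : ∀ H : History K T,
      ∑ i, ∑ n ∈ Finset.range (pulls H i T), gapBound T ε B μ i n ≤ D) :
    regret ν π T ≤ D + 2 * K * ∑ n ∈ Finset.range T, ((n : ℝ) + 1) ^ (1 - α) := by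
  set bad : Fin T → Set (History K T) := fun s =>
    (fun H => truncate H s s.2.le) ⁻¹' badEvent σ ε α μ s with hbad
  have hbadm (s : Fin T) : MeasurableSet (bad s) :=
    measurable_truncate _ _ (measurableSet_badEvent σ ε α μ s)
  have hprob (s : Fin T) : (histLaw ν π T).real (bad s) ≤
      2 * K * (((s : ℕ) : ℝ) + 1) ^ (1 - α) := by
    rw [hbad, ← map_measureReal_apply (measurable_truncate _ _) (measurableSet_badEvent σ ε α μ s),
      map_truncate_histLaw]
    exact histLaw_badEvent_le hσ hν π hε' hα s.2
  have hae : ∀ᵐ H ∂(histLaw ν π T), ∑ s : Fin T, (bestPayoff μ (s + 1) - μ (H s).1 (s + 1)) ≤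
      D + ∑ s : Fin T, (bad s).indicator 1 H := by
    filter_upwards [ae_eq_act ν π T] with H hH
    refine le_trans ?_ (add_le_add_left (hD H) _)
    rw [← sum_gapBound_eq, ← Finset.sum_add_distrib]
    refine Finset.sum_le_sum fun s _ => ?_
    have : Nonempty (Fin K) := ⟨(H s).1⟩
    have hgb := gapBound_nonneg hν ε B (H s).1 (pulls H (H s).1 s)
    by_cases hs : H ∈ bad s
    · rw [Set.indicator_of_mem hs, Pi.one_apply]
      have h₁ : bestPayoff μ (s + 1) ≤ 1 :=
        ciSup_le fun j => (hν.bounded j (s + 1) ⟨by omega, s.2⟩).2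
      have h₂ := (hν.bounded (H s).1 (s + 1) ⟨by omega, s.2⟩).1
      linarith
    · rw [Set.indicator_of_notMem hs, add_zero]
      have := bestPayoff_sub_le_gapBound hσ hν hε hε' hα hB s.2 (truncate H s s.2.le) hs (H s).1
        (fun j => by rw [hH s]; exact hπ s s.2 _ j)
      rwa [pulls_truncate H (H s).1 s.2.le le_rfl] at this
  have hind (s : Fin T) : Integrable ((bad s).indicator (1 : History K T → ℝ)) (histLaw ν π T) :=
    (integrable_const (1 : ℝ)).indicator (hbadm s)
  have hint₁ : Integrable (fun H : History K T =>
      ∑ s : Fin T, (bestPayoff μ (s + 1) - μ (H s).1 (s + 1))) (histLaw ν π T) := by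
    simp_rw [Finset.sum_sub_distrib]
    exact (integrable_const _).sub (integrable_payoff hν π)
  have hint₂ : Integrable (fun H : History K T => ∑ s : Fin T, (bad s).indicator (1 : History K T → ℝ) H)
      (histLaw ν π T) := integrable_finsetSum _ fun s _ => hind s
  calc regret ν π T ≤ _ := regret_le_integral hν π
    _ ≤ ∫ H, (D + ∑ s : Fin T, (bad s).indicator 1 H) ∂(histLaw ν π T) :=
      integral_mono_ae hint₁ ((integrable_const D).add hint₂) hae
    _ = D + ∑ s : Fin T, (histLaw ν π T).real (bad s) := by
      rw [integral_add (integrable_const D) hint₂, integral_finsetSum _ fun s _ => hind s]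
      simp [integral_indicator_one (hbadm _)]
    _ ≤ D + ∑ s : Fin T, 2 * K * (((s : ℕ) : ℝ) + 1) ^ (1 - α) := by
      gcongr with s
      exact hprob s
    _ = _ := by
      rw [Finset.mul_sum, Fin.sum_univ_eq_sum_range
        (fun n : ℕ => 2 * (K : ℝ) * ((n : ℝ) + 1) ^ (1 - α)) T]

lemma regret_le_horizon (hν : IsRisingRestless T σ ν μ) (π : Policy K) : regret ν π T ≤ T := by
  refine (regret_le_integral hν π).trans ?_
  have hint : Integrable (fun H : History K T =>
      ∑ s : Fin T, (bestPayoff μ (s + 1) - μ (H s).1 (s + 1))) (histLaw ν π T) := by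
    simp_rw [Finset.sum_sub_distrib]
    exact (integrable_const _).sub (integrable_payoff hν π)
  have hle (H : History K T) :
      ∑ s : Fin T, (bestPayoff μ (s + 1) - μ (H s).1 (s + 1)) ≤ T := by
    have := Finset.sum_le_card_nsmul (Finset.univ : Finset (Fin T))
      (fun s => bestPayoff μ (s + 1) - μ (H s).1 (s + 1)) 1 fun s _ => by
        have : Nonempty (Fin K) := ⟨(H s).1⟩
        have h₁ : bestPayoff μ (s + 1) ≤ 1 :=
          ciSup_le fun j => (hν.bounded j (s + 1) ⟨by omega, s.2⟩).2
        have h₂ := (hν.bounded (H s).1 (s + 1) ⟨by omega, s.2⟩).1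
        linarith
    simpa using this
  calc _ ≤ ∫ _, (T : ℝ) ∂(histLaw ν π T) := integral_mono hint (integrable_const _) hle
    _ = T := by simp

/-- Continuing the increments by `0` does not change the cumulative increment as long as that only
involves rounds before `T`. -/
lemma cumIncrement_eq_sum {M : ℕ} (hM : M ≤ T) (q : ℝ) :
    cumIncrement μ M q = ∑ j ∈ Finset.range (M - 1), ⨆ i : Fin K, slope T μ i (j + 1) ^ q := by
  rw [cumIncrement, Finset.sum_Ico_eq_sum_range]
  refine Finset.sum_congr rfl fun j hj => ?_
  rw [Finset.mem_range] at hj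
  refine iSup_congr fun i => ?_
  rw [slope, if_pos (by omega), add_comm]

lemma half_le_ceil_sub_one {y : ℝ} (hy : 1 < y) : y / 2 ≤ ((⌈y⌉₊ - 1 : ℕ) : ℝ) := by
  have h₁ : 2 ≤ ⌈y⌉₊ := Nat.lt_ceil.2 (by simpa using hy)
  have h₂ : (2 : ℝ) ≤ ⌈y⌉₊ := by exact_mod_cast h₁
  have h₃ := Nat.le_ceil y
  rw [Nat.cast_sub (by omega), Nat.cast_one]
  linarith

/-- The accumulated gaps, for any way of distributing the `T` rounds among the arms. -/
lemma sum_gapBound_le (hν : IsRisingRestless T σ ν μ) {ε B q : ℝ} (hε : 0 < ε)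
    (hε' : ε < 1 / 2) (hq : 0 < q) (hB : 0 < B) (hT : 1 ≤ Real.log T) (hK : 0 < K)
    (hKT : (K : ℝ) < (1 - 2 * ε) * T) (H : History K T) :
    ∑ i, ∑ n ∈ Finset.range (pulls H i T), gapBound T ε B μ i n ≤
      K * (2 / ε * (3 * B + 2)) +
        40 * ((K : ℝ) * (T : ℝ) ^ (2 * q / (1 + q)) * Real.log T ^ (q / (1 + q)) /
          (ε * (1 - 2 * ε)) *
            cumIncrement μ ⌈(1 - 2 * ε) * (T : ℝ) / (K : ℝ)⌉₊ q ^ (1 / (1 + q))) := by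
  have hK0 : (0 : ℝ) < K := by exact_mod_cast hK
  have hK1 : (1 : ℝ) ≤ K := by exact_mod_cast hK
  set c : ℝ := 1 - 2 * ε with hc
  have hc0 : 0 < c := by rw [hc]; linarith
  have hc1 : c ≤ 1 := by rw [hc]; linarith
  set y : ℝ := c * T / K with hy
  have hy1 : 1 < y := by rw [hy, lt_div_iff₀ hK0]; linarith
  have hyT : ⌈y⌉₊ ≤ T := by
    rw [Nat.ceil_le, hy, div_le_iff₀ hK0]
    have : c * (T : ℝ) ≤ 1 * T := by gcongr
    nlinarith [Nat.cast_nonneg (α := ℝ) T]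
  set m : ℕ := ⌈y⌉₊ - 1 with hm
  have hym : y / 2 ≤ m := half_le_ceil_sub_one hy1
  have hm1 : 1 ≤ m := by
    have : 1 < ⌈y⌉₊ := Nat.lt_ceil.2 (by simpa using hy1)
    omega
  have hm0 : (0 : ℝ) < m := by exact_mod_cast hm1
  set g : ℕ → ℝ := fun j => ⨆ i : Fin K, slope T μ i (j + 1) ^ q with hg
  have : Nonempty (Fin K) := ⟨⟨0, hK⟩⟩
  have hγ (i : Fin K) (j : ℕ) : 0 ≤ slope T μ i (j + 1) := slope_nonneg hν i (by omega)
  have hγg (i : Fin K) (j : ℕ) : slope T μ i (j + 1) ^ q ≤ g j :=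
    le_ciSup (f := fun i : Fin K => slope T μ i (j + 1) ^ q) (Set.finite_range _).bddAbove i
  have hg0 (j : ℕ) : 0 ≤ g j := Real.iSup_nonneg fun i => Real.rpow_nonneg (hγ i j) _
  have hganti : Antitone g := fun j j' hjj => ciSup_le fun i =>
    (Real.rpow_le_rpow (hγ i j') (slope_anti hν i (by omega) (by omega)) hq.le).trans (hγg i j)
  rw [cumIncrement_eq_sum hyT]
  change _ ≤ _ + 40 * (_ * (∑ j ∈ Finset.range m, g j) ^ (1 / (1 + q)))
  set W : ℝ := (T : ℝ) ^ (2 * q / (1 + q)) * Real.log T ^ (q / (1 + q)) / (ε * c) *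
    (∑ j ∈ Finset.range m, g j) ^ (1 / (1 + q)) with hW
  have hW0 : 0 ≤ W := by
    have h₁ : 0 ≤ Real.log T ^ (q / (1 + q)) := Real.rpow_nonneg (by linarith) _
    have h₂ : 0 ≤ (∑ j ∈ Finset.range m, g j) ^ (1 / (1 + q)) :=
      Real.rpow_nonneg (Finset.sum_nonneg fun j _ => hg0 j) _
    positivity
  have harm (i : Fin K) : ∑ n ∈ Finset.range (pulls H i T), gapBound T ε B μ i n ≤
      2 / ε * (3 * B + 2) + 8 * W * (1 + (c * pulls H i T + 1) / m) := by
    simp only [gapBound]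
    rw [Finset.sum_add_distrib]
    exact add_le_add (sum_bonus_le hε (by linarith) hB _)
      (sum_bias_le hε hε' hq hT (γ := fun j => slope T μ i (j + 1)) (hγ i) hg0 hganti (hγg i)
        (pulls_le H i T) hm1)
  have hpulls : ∑ i, (pulls H i T : ℝ) = T := by exact_mod_cast sum_pulls_eq H
  have hsum : ∑ i : Fin K, (1 + (c * pulls H i T + 1) / (m : ℝ)) ≤ 5 * K := by
    rw [Finset.sum_add_distrib, ← Finset.sum_div, Finset.sum_add_distrib, ← Finset.mul_sum, hpulls]
    simp only [Finset.sum_const, Finset.card_univ, Fintype.card_fin, nsmul_eq_mul, mul_one]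
    have h₁ : c * T = y * K := by rw [hy]; field_simp
    have h₂ : (c * T + K) / (m : ℝ) ≤ 4 * K := by
      rw [div_le_iff₀ hm0, h₁]
      nlinarith
    linarith
  calc _ ≤ ∑ i : Fin K, (2 / ε * (3 * B + 2) + 8 * W * (1 + (c * pulls H i T + 1) / m)) :=
        Finset.sum_le_sum fun i _ => harm i
    _ = K * (2 / ε * (3 * B + 2)) + 8 * W * ∑ i : Fin K, (1 + (c * pulls H i T + 1) / (m : ℝ)) := by
        rw [Finset.sum_add_distrib, Finset.mul_sum]
        simp only [Finset.sum_const, Finset.card_univ, Fintype.card_fin, nsmul_eq_mul]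
    _ ≤ K * (2 / ε * (3 * B + 2)) + 8 * W * (5 * K) := by gcongr
    _ = _ := by rw [hW]; ring

/-- For `q = 0` the cumulative increment counts rounds and the claim is weaker than
`regret_le_horizon`. -/
lemma horizon_le_of_exponent_zero {ε : ℝ} (hε : 0 < ε) (hε' : ε < 1 / 2) (hK : 0 < K)
    (hKT : (K : ℝ) < (1 - 2 * ε) * T) :
    (T : ℝ) ≤ (K : ℝ) / (ε * (1 - 2 * ε)) *
      cumIncrement μ ⌈(1 - 2 * ε) * (T : ℝ) / (K : ℝ)⌉₊ 0 := by
  have hK0 : (0 : ℝ) < K := by exact_mod_cast hK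
  have : Nonempty (Fin K) := ⟨⟨0, hK⟩⟩
  have hc0 : 0 < 1 - 2 * ε := by linarith
  have hhalf := half_le_ceil_sub_one (y := (1 - 2 * ε) * (T : ℝ) / K)
    (by rw [lt_div_iff₀ hK0]; linarith)
  have hcum : cumIncrement μ ⌈(1 - 2 * ε) * (T : ℝ) / (K : ℝ)⌉₊ 0 =
      ((⌈(1 - 2 * ε) * (T : ℝ) / (K : ℝ)⌉₊ - 1 : ℕ) : ℝ) := by
    simp [cumIncrement]
  rw [hcum]
  calc (T : ℝ) ≤ T / (2 * ε) := by
        rw [le_div_iff₀ (by positivity)]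
        nlinarith [Nat.cast_nonneg (α := ℝ) T]
    _ = (K : ℝ) / (ε * (1 - 2 * ε)) * ((1 - 2 * ε) * (T : ℝ) / K / 2) := by
        field_simp
    _ ≤ _ := by gcongr

end Payoff

lemma exists_horizon_threshold {σ α : ℝ} (hσ : 0 < σ) (hα : 1 ≤ α) (c : ℝ) :
    ∃ T₀ : ℕ, ∀ T : ℕ, T₀ ≤ T → 1 ≤ Real.log T ∧
      c ≤ (σ * T) ^ ((2 : ℝ) / 3) * (α * Real.log T) ^ ((1 : ℝ) / 3) := by
  have h₁ : ∀ᶠ T : ℕ in Filter.atTop, 1 ≤ Real.log T :=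
    (Real.tendsto_log_atTop.comp tendsto_natCast_atTop_atTop).eventually_ge_atTop 1
  have h₂ : ∀ᶠ T : ℕ in Filter.atTop, c ≤ (σ * T) ^ ((2 : ℝ) / 3) :=
    ((tendsto_rpow_atTop (by norm_num)).comp
      (tendsto_natCast_atTop_atTop.const_mul_atTop hσ)).eventually_ge_atTop c
  obtain ⟨T₀, hT₀⟩ := Filter.eventually_atTop.1 (h₁.and h₂)
  refine ⟨T₀, fun T hT => ⟨(hT₀ T hT).1, (hT₀ T hT).2.trans (le_mul_of_one_le_right ?_ ?_)⟩⟩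
  · positivity
  · exact Real.one_le_rpow (one_le_mul_of_one_le_of_one_le hα (hT₀ T hT).1) (by norm_num)

/-- For `s = σ T` and `L = α log T`, this `B` is the window length at which the bound
`√(B³ / h³)` for twice the exploration bonus reaches the trivial bound `1` of a gap. -/
lemma exists_bonus_threshold {s L : ℝ} (hs : 0 < s) (hL : 0 < L) :
    ∃ B : ℝ, 0 < B ∧ B ^ 3 = 40 * s ^ 2 * L ∧
      B ≤ 4 * (s ^ ((2 : ℝ) / 3) * L ^ ((1 : ℝ) / 3)) := by
  have hcube {x : ℝ} (hx : 0 ≤ x) : (x ^ ((1 : ℝ) / 3)) ^ 3 = x := by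
    rw [← Real.rpow_natCast, ← Real.rpow_mul hx]
    norm_num
  refine ⟨(40 * s ^ 2 * L) ^ ((1 : ℝ) / 3), by positivity, hcube (by positivity), ?_⟩
  refine le_of_pow_le_pow_left₀ (n := 3) (by norm_num) (by positivity) ?_
  rw [hcube (by positivity), mul_pow, mul_pow, hcube hL.le, show (s ^ ((2 : ℝ) / 3)) ^ 3 = s ^ 2 by
    rw [← Real.rpow_natCast, ← Real.rpow_mul hs.le, ← Real.rpow_natCast]; norm_num]
  have : 0 ≤ s ^ 2 * L := by positivity
  linarith

end RisingBandit

theorem mainTheorem5 :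
    ∃ C : ℝ, 0 < C ∧ ∀ σ α : ℝ, 0 < σ → 2 < α →
      ∃ T₀ : ℕ, ∀ (K T : ℕ) (ε : ℝ), 0 < ε → ε < 1 / 2 → T₀ ≤ T →
        (K : ℝ) < (1 - 2 * ε) * T →
        ∀ (ν : RisingBandit.Bandit K) (μ : Fin K → ℕ → ℝ),
          RisingBandit.IsRisingRestless T σ ν μ →
          ∀ π : RisingBandit.Policy K, RisingBandit.IsRLessUCB T σ ε α π →
            ∀ q : ℝ, 0 ≤ q → q ≤ 1 →
              RisingBandit.regret ν π T ≤
                C * ((K : ℝ) / ε * (σ * T) ^ ((2 : ℝ) / 3) * (α * Real.log T) ^ ((1 : ℝ) / 3) +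
                  (K : ℝ) * (T : ℝ) ^ (2 * q / (1 + q)) * Real.log T ^ (q / (1 + q)) /
                      (ε * (1 - 2 * ε)) *
                    RisingBandit.cumIncrement μ ⌈(1 - 2 * ε) * (T : ℝ) / (K : ℝ)⌉₊ q ^
                      (1 / (1 + q))) := by
  refine ⟨40, by norm_num, fun σ α hσ hα => ?_⟩
  -- `α > 2` makes the probabilities of the bad events summable over all rounds
  have hsummable : Summable fun n : ℕ => ((n : ℝ) + 1) ^ (1 - α) := by
    have h := (summable_nat_add_iff 1).2 (Real.summable_nat_rpow.2 (by linarith : 1 - α < -1))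
    simpa using h
  set S : ℝ := ∑' n : ℕ, ((n : ℝ) + 1) ^ (1 - α) with hS
  have hS0 : 0 ≤ S := tsum_nonneg fun n => by positivity
  obtain ⟨T₀, hT₀⟩ := RisingBandit.exists_horizon_threshold hσ (by linarith : 1 ≤ α) (1 + 2 * S)
  refine ⟨T₀, fun K T ε hε hε' hT hKT ν μ hν π hπ q hq _ => ?_⟩
  obtain ⟨hlog, hX⟩ := hT₀ T hT
  have hK : 0 < K := (π.act 0 fun s => s.elim0).pos
  have hT0 : (0 : ℝ) < T := by
    rcases Nat.eq_zero_or_pos T with rfl | h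
    · simp at hlog; linarith
    · exact_mod_cast h
  rw [mul_assoc ((K : ℝ) / ε)]
  set X : ℝ := (σ * T) ^ ((2 : ℝ) / 3) * (α * Real.log T) ^ ((1 : ℝ) / 3) with hXdef
  have hX0 : 0 ≤ X := by linarith
  have hKε : 0 < (K : ℝ) / ε := div_pos (by exact_mod_cast hK) hε
  rcases hq.eq_or_lt with rfl | hq
  -- at `q = 0` the conjugate exponent `(1 + q) / q` of Hölder's inequality degenerates
  · have h₁ := RisingBandit.regret_le_horizon hν π
    have h₂ := RisingBandit.horizon_le_of_exponent_zero (μ := μ) hε hε' hK hKT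
    simp only [mul_zero, Real.rpow_zero, mul_one, add_zero, div_one, Real.rpow_one]
    have h₃ : 0 ≤ (K : ℝ) / ε * X := by positivity
    linarith
  · obtain ⟨B, hB0, hB3, hBX⟩ := RisingBandit.exists_bonus_threshold (s := σ * T)
      (L := α * Real.log T) (by positivity) (mul_pos (by linarith) (by linarith))
    have hreg := RisingBandit.regret_le_add_of_sum_gapBound_le hσ hν hε hε' (by linarith) hπ hB3
      (RisingBandit.sum_gapBound_le hν hε hε' hq hB0 hlog hK hKT)
    have hbad : ∑ n ∈ Finset.range T, ((n : ℝ) + 1) ^ (1 - α) ≤ S :=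
      hsummable.sum_le_tsum _ fun n _ => by positivity
    have hKle : (K : ℝ) ≤ K / ε := by
      rw [le_div_iff₀ hε]
      nlinarith [Nat.cast_nonneg (α := ℝ) K]
    have h₁ : 2 * (K : ℝ) * ∑ n ∈ Finset.range T, ((n : ℝ) + 1) ^ (1 - α) ≤ K / ε * X := by
      calc _ ≤ 2 * (K : ℝ) * S := by gcongr
        _ = K * (2 * S) := by ring
        _ ≤ K / ε * X := by gcongr; linarith
    have h₂ : (K : ℝ) * (2 / ε * (3 * B + 2)) ≤ 28 * (K / ε * X) := by
      calc (K : ℝ) * (2 / ε * (3 * B + 2)) = K / ε * (6 * B + 4) := by ring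
        _ ≤ K / ε * (28 * X) := by gcongr; linarith
        _ = _ := by ring
    have h₃ : 0 ≤ (K : ℝ) / ε * X := by positivity
    linarith
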